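/- **Conventions.** All random variables live on one probability space and are real-valued. For functions $f,g\ge 0$ of $(x,y)$, $f\sim g$ as $x\wedge y\to\infty$ means $f-g=o(g)$, i.e. for each $\varepsilon>0$ there is $M$ with $|f-g|\le\varepsilon g$ whenever $x,y\ge M$ (so $f/g\to1$ where $g>0$). Write $\bar F(x)=P[X>x]$ for $X$ with distribution $F$; ratios of tails are understood to have positive denominators. *One-dimensional classes.* $F\in\mathcal L$ if $\bar F(x-a)/\bar F(x)\to1$ as $x\to\infty$ for all $a>0$; $F\in\mathcal D$ if $\limsup_{x\to\infty}\bar F(bx)/\bar F(x)<\infty$ for all $b\in(0,1)$; $F\in\mathcal C$ if $\lim_{z\uparrow1}\limsup_{x\to\infty}\bar F(zx)/\bar F(x)=1$. The upper Matuszewska index is $J_F^+=\inf\{-\ln\bar F_*(v)/\ln v: v>1\}$ with $\bar F_*(v)=\liminf_{x\to\infty}\bar F(vx)/\bar F(x)$. *Two-dimensional classes.* Let $X,Y$ have distributions $F,G$. $(X,Y)\in\mathcal L^{(2)}$ if $F,G\in\mathcal L$ and $P[X>x-a_1,Y>y-a_2]/P[X>x,Y>y]\to1$ as $x\wedge y\to\infty$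 for all $(a_1,a_2)\in[0,\infty)^2\setminus\{(0,0)\}$. $(X,Y)\in\mathcal D^{(2)}$ if $F,G\in\mathcal D$ and $\limsup_{x\wedge y\to\infty}P[X>b_1x,Y>b_2y]/P[X>x,Y>y]<\infty$ for all $b_1,b_2\in(0,1)$. $(X,Y)\in\mathcal C^{(2)}$ if $F,G\in\mathcal C$ and $\lim_{(z_1,z_2)\uparrow(1,1)}\limsup_{x\wedge y\to\infty}P[X>z_1x,Y>z_2y]/P[X>x,Y>y]=1$. Put $(\mathcal D\cap\mathcal L)^{(2)}=\mathcal D^{(2)}\cap\mathcal L^{(2)}$. *Dependence.* $X_1,\dots,X_n$ are TAI if $P[|X_i|>x_i\mid X_j>x_j]\to0$ as $x_i\wedge x_j\to\infty$ for all $i\ne j$. The sequences $X_1,\dots,X_n$ and $Y_1,\dots,Y_m$ are GTAI if $P[|X_i|>x_i\mid X_k>x_k,\,Y_j>y_j]\to0$ as $x_i\wedge x_k\wedge y_j\to\infty$ for all $i\neq k$ and all $j$, and the same holds with the roles of the two sequences exchanged. They are GQAI if $$\frac{P[|X_i|>x,\;X_k>x,\;Y_j>y]}{P[X_i>x,Y_j>y]+P[X_k>x,Y_j>y]}\to0\qquad(x\wedge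 y\to\infty)$$ for all $i\neq k$ and all $j$, and the same holds with the roles of the two sequences exchanged. *Assumption A* for weights $(\Theta,\Delta)$ of a pair $(X,Y)$: there are functions $b,c:[0,\infty)\to(0,\infty)$ with $b(x)\to\infty$, $b(x)=o(x)$, $c(y)\to\infty$, $c(y)=o(y)$ such that $P[\Theta>b(x)]=o(P[\Theta X>x,\Delta Y>y])$ as $x\to\infty$ with $y$ free (i.e. uniformly in $y\in\mathbb R$), and $P[\Delta>c(y)]=o(P[\Theta X>x,\Delta Y>y])$ as $y\to\infty$ with $x$ free (i.e. uniformly in $x\in\mathbb R$). *Standing assumption on the weights.* $\Theta_1,\dots,\Theta_n,\Delta_1,\dots,\Delta_m$ are non-negative random variables, none of them almost surely zero, arbitrarily dependent on each other; the family of all weights is independent of the family $X_1,\dots,X_n,Y_1,\dots,Y_m$; and for all $i,j$ the weights $(\Theta_i,\Delta_j)$ of the pair $(X_i,Y_j)$ satisfy Assumption A. Put $S_k^\Theta=\sum_{i=1}^k\Theta_iX_i$ and $T_l^\Delta=\sum_{j=1}^l\Delta_jY_j$. **Theorem 5.1.** (1) Let $n,m\ge1$, let $X_1,\dots,X_n$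 and $Y_1,\dots,Y_m$ be GQAI with distributions in $\mathcal C$ and $(X_i,Y_j)\in\mathcal C^{(2)}$ for all $i,j$, and let the weights satisfy the standing assumption. Then, as $x\wedge y\to\infty$, $$P[S_n^\Theta>x,\,T_m^\Delta>y]\sim P\Big[\max_{1\le k\le n}S_k^\Theta>x,\;\max_{1\le l\le m}T_l^\Delta>y\Big]\sim\sum_{i=1}^n\sum_{j=1}^mP[\Theta_iX_i>x,\;\Delta_jY_j>y].$$ (2) Let $n=m\ge1$, let $X_1,\dots,X_n$ and $Y_1,\dots,Y_n$ be GTAI with distributions $F_1,\dots,F_n$ and $G_1,\dots,G_n$ in $\mathcal D\cap\mathcal L$ and $(X_i,Y_j)\in(\mathcal D\cap\mathcal L)^{(2)}$ for all $i,j$, let $X_1,\dots,X_n$ be TAI and $Y_1,\dots,Y_n$ be TAI, and let the weights satisfy the standing assumption. Suppose that $E[\Theta_i^p]<\infty$ for all $i$, for some $p>\max_iJ_{F_i}^+$, and $E[\Delta_j^q]<\infty$ for all $j$, for some $q>\max_jJ_{G_j}^+$. Then, as $x\wedge y\to\infty$, $$P[S_n^\Theta>x,\,T_n^\Delta>y]\sim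 P\Big[\max_{k\le n}S_k^\Theta>x,\;\max_{l\le n}T_l^\Delta>y\Big]\sim P\Big[\max_{i\le n}\Theta_iX_i>x,\;\max_{j\le n}\Delta_jY_j>y\Big]\sim\sum_{i=1}^n\sum_{j=1}^nP[\Theta_iX_i>x,\;\Delta_jY_j>y].$$ -/

import Mathlib

open Filter Topology MeasureTheory ProbabilityTheory Asymptotics
open scoped ENNReal

namespace HeavyTail

variable {Ω : Type*} [MeasurableSpace Ω]

/-- The tail `P[X > x]` of the distribution of `X`. -/
noncomputable def tail (P : Measure Ω) (X : Ω → ℝ) (x : ℝ) : ℝ≥0∞ :=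
  P {ω | x < X ω}

/-- The joint tail `P[X > x, Y > y]`. -/
noncomputable def jointTail (P : Measure Ω) (X Y : Ω → ℝ) (x y : ℝ) : ℝ≥0∞ :=
  P {ω | x < X ω ∧ y < Y ω}

/-! ### One-dimensional classes

Ratios of tails are taken in `[0, ∞]`, so that every `limsup` and `liminf` below is a genuine one.
The limit `x ∧ y → ∞` is the filter `atTop ×ˢ atTop`. -/

/-- Long tailed distributions. -/
def ClassL (P : Measure Ω) (X : Ω → ℝ) : Prop :=
  ∀ a : ℝ, 0 < a → Tendsto (fun x => tail P X (x - a) / tail P X x) atTop (𝓝 1)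

/-- Dominatedly varying distributions. The first clause (unbounded upper support) says that the
ratio in the second one is well defined. -/
def ClassD (P : Measure Ω) (X : Ω → ℝ) : Prop :=
  (∀ x, 0 < tail P X x) ∧
  ∀ b : ℝ, 0 < b → b < 1 → limsup (fun x => tail P X (b * x) / tail P X x) atTop < ∞

/-- Consistently varying distributions. -/
def ClassC (P : Measure Ω) (X : Ω → ℝ) : Prop :=
  Tendsto (fun z : ℝ => limsup (fun x => tail P X (z * x) / tail P X x) atTop) (𝓝[<] 1) (𝓝 1)

/-- The upper Matuszewska index
`inf { - ln F_*(v) / ln v : v > 1 }`, `F_*(v) = liminf_{x → ∞} P[X > v x] / P[X > x]`,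
as an extended real number (`ln 0 = -∞`). -/
noncomputable def upperMatuszewska (P : Measure Ω) (X : Ω → ℝ) : EReal :=
  ⨅ v ∈ Set.Ioi (1 : ℝ),
    (-ENNReal.log (liminf (fun x => tail P X (v * x) / tail P X x) atTop)) /
      ((Real.log v : ℝ) : EReal)

/-! ### Two-dimensional classes -/

/-- Bivariate long tailed pairs. -/
def ClassL2 (P : Measure Ω) (X Y : Ω → ℝ) : Prop :=
  ClassL P X ∧ ClassL P Y ∧
  ∀ a₁ a₂ : ℝ, 0 ≤ a₁ → 0 ≤ a₂ → (a₁, a₂) ≠ (0, 0) →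
    Tendsto (fun p : ℝ × ℝ => jointTail P X Y (p.1 - a₁) (p.2 - a₂) / jointTail P X Y p.1 p.2)
      (atTop ×ˢ atTop) (𝓝 1)

/-- Bivariate dominatedly varying pairs. The positivity clause says that the ratio is well
defined. -/
def ClassD2 (P : Measure Ω) (X Y : Ω → ℝ) : Prop :=
  ClassD P X ∧ ClassD P Y ∧ (∀ x y, 0 < jointTail P X Y x y) ∧
  ∀ b₁ b₂ : ℝ, 0 < b₁ → b₁ < 1 → 0 < b₂ → b₂ < 1 →
    limsup (fun p : ℝ × ℝ => jointTail P X Y (b₁ * p.1) (b₂ * p.2) / jointTail P X Y p.1 p.2)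
      (atTop ×ˢ atTop) < ∞

/-- Bivariate consistently varying pairs. -/
def ClassC2 (P : Measure Ω) (X Y : Ω → ℝ) : Prop :=
  ClassC P X ∧ ClassC P Y ∧
  Tendsto (fun z : ℝ × ℝ =>
      limsup (fun p : ℝ × ℝ =>
        jointTail P X Y (z.1 * p.1) (z.2 * p.2) / jointTail P X Y p.1 p.2) (atTop ×ˢ atTop))
    (𝓝[<] 1 ×ˢ 𝓝[<] 1) (𝓝 1)

/-! ### Dependence structures -/

/-- Tail asymptotic independence of a finite sequence. -/
def TAI (P : Measure Ω) {n : ℕ} (X : Fin n → Ω → ℝ) : Prop :=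
  ∀ i j, i ≠ j →
    Tendsto (fun p : ℝ × ℝ => P[{ω | p.1 < |X i ω|} | {ω | p.2 < X j ω}])
      (atTop ×ˢ atTop) (𝓝 0)

/-- One half of generalized tail asymptotic independence: two `X`'s against one `Y`. -/
def HalfGTAI (P : Measure Ω) {n m : ℕ} (X : Fin n → Ω → ℝ) (Y : Fin m → Ω → ℝ) : Prop :=
  ∀ i k, i ≠ k → ∀ j,
    Tendsto (fun p : ℝ × ℝ × ℝ =>
        P[{ω | p.1 < |X i ω|} | {ω | p.2.1 < X k ω ∧ p.2.2 < Y j ω}])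
      (atTop ×ˢ atTop ×ˢ atTop) (𝓝 0)

/-- Generalized tail asymptotic independence of two finite sequences. -/
def GTAI (P : Measure Ω) {n m : ℕ} (X : Fin n → Ω → ℝ) (Y : Fin m → Ω → ℝ) : Prop :=
  HalfGTAI P X Y ∧ HalfGTAI P Y X

/-- One half of generalized quasi asymptotic independence: two `X`'s against one `Y`. -/
def HalfGQAI (P : Measure Ω) {n m : ℕ} (X : Fin n → Ω → ℝ) (Y : Fin m → Ω → ℝ) : Prop :=
  ∀ i k, i ≠ k → ∀ j,
    Tendsto (fun p : ℝ × ℝ =>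
        P {ω | p.1 < |X i ω| ∧ p.1 < X k ω ∧ p.2 < Y j ω} /
          (jointTail P (X i) (Y j) p.1 p.2 + jointTail P (X k) (Y j) p.1 p.2))
      (atTop ×ˢ atTop) (𝓝 0)

/-- Generalized quasi asymptotic independence of two finite sequences. -/
def GQAI (P : Measure Ω) {n m : ℕ} (X : Fin n → Ω → ℝ) (Y : Fin m → Ω → ℝ) : Prop :=
  HalfGQAI P X Y ∧ HalfGQAI P Y X

/-! ### Random weights -/

/-- The condition on the weights `Θ, Δ` of the pair `X, Y`. The filter `atTop ×ˢ ⊤` on pairs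
`(x, y)` means `x → ∞` while `y` is free (no restriction on `y`); `⊤ ×ˢ atTop` means `y → ∞`
while `x` is free. -/
def WeightCondition (P : Measure Ω) (Θ Δ X Y : Ω → ℝ) : Prop :=
  (∃ b : ℝ → ℝ, (∀ x, 0 ≤ x → 0 < b x) ∧ Tendsto b atTop atTop ∧ b =o[atTop] (fun x => x) ∧
    (fun p : ℝ × ℝ => P.real {ω | b p.1 < Θ ω}) =o[atTop ×ˢ ⊤]
      (fun p : ℝ × ℝ => P.real {ω | p.1 < Θ ω * X ω ∧ p.2 < Δ ω * Y ω})) ∧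
  (∃ c : ℝ → ℝ, (∀ y, 0 ≤ y → 0 < c y) ∧ Tendsto c atTop atTop ∧ c =o[atTop] (fun y => y) ∧
    (fun p : ℝ × ℝ => P.real {ω | c p.2 < Δ ω}) =o[⊤ ×ˢ atTop]
      (fun p : ℝ × ℝ => P.real {ω | p.1 < Θ ω * X ω ∧ p.2 < Δ ω * Y ω}))

/-- The standing assumptions on the weights: random variables, non-negative, not degenerate at
zero, independent (jointly, as one family) of the family of all `X`'s and `Y`'s, and satisfying the
weight condition for every pair of indices. The weights may depend on each other arbitrarily. -/
structure AdmissibleWeights (P : Measure Ω) {n m : ℕ} (X : Fin n → Ω → ℝ) (Y : Fin m → Ω → ℝ)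
    (Θ : Fin n → Ω → ℝ) (Δ : Fin m → Ω → ℝ) : Prop where
  measurable_left : ∀ i, Measurable (Θ i)
  measurable_right : ∀ j, Measurable (Δ j)
  nonneg_left : ∀ i, 0 ≤ᵐ[P] Θ i
  nonneg_right : ∀ j, 0 ≤ᵐ[P] Δ j
  nondegenerate_left : ∀ i, ¬ Θ i =ᵐ[P] 0
  nondegenerate_right : ∀ j, ¬ Δ j =ᵐ[P] 0
  indep : IndepFun (fun ω => ((fun i => Θ i ω), (fun j => Δ j ω)))
    (fun ω => ((fun i => X i ω), (fun j => Y j ω))) P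
  condition : ∀ i j, WeightCondition P (Θ i) (Δ j) (X i) (Y j)

/-- The weighted sum `∑ Θ_i X_i`. -/
noncomputable def wSum {n : ℕ} (Θ X : Fin n → Ω → ℝ) (ω : Ω) : ℝ :=
  ∑ i, Θ i ω * X i ω

/-- The maximum over `k` of the partial sums `∑_{i ≤ k} Θ_i X_i`. -/
noncomputable def wMaxSum {n : ℕ} (Θ X : Fin n → Ω → ℝ) (ω : Ω) : ℝ :=
  ⨆ k : Fin n, ∑ i ∈ Finset.Iic k, Θ i ω * X i ω

/-- The maximum of the weighted terms `Θ_i X_i`. -/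
noncomputable def wMax {n : ℕ} (Θ X : Fin n → Ω → ℝ) (ω : Ω) : ℝ :=
  ⨆ i : Fin n, Θ i ω * X i ω

/-- The double sum `∑_i ∑_j P[Θ_i X_i > x, Δ_j Y_j > y]` as a function of `(x, y)`. -/
noncomputable def doubleSum (P : Measure Ω) {n m : ℕ} (X : Fin n → Ω → ℝ) (Y : Fin m → Ω → ℝ)
    (Θ : Fin n → Ω → ℝ) (Δ : Fin m → Ω → ℝ) (p : ℝ × ℝ) : ℝ :=
  ∑ i, ∑ j, P.real {ω | p.1 < Θ i ω * X i ω ∧ p.2 < Δ j ω * Y j ω}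

end HeavyTail

/-!
The key observation is that the condition on the weights makes them bounded: the estimate
`P[Θ > b(x)] = o(P[Θ X > x, Δ Y > y])` is uniform in `y`, and for a fixed large `x` the right-hand
side tends to zero as `y → ∞`, so `P[Θ > b(x)] = 0` (`AdmissibleWeights.exists_boundedWeights`).
With bounded weights, `x / Θ` is large whenever `x` is, so that statements about the tails of
`(X, Y)` can be integrated over the weights.

Write `W i = Θ i * X i` and `V j = Δ j * Y j`. Both asymptotic statements follow from one version of
the principle of a single big jump, `isEquivalent_of_gap`. It applies to all the functionals in
question (sums, maxima of partial sums, maxima), because each is at most the sum of the positive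
parts and exceeds `x` as soon as one term exceeds `x + g` and the others are at most `g / n` in
absolute value (`JumpFunctional`). It needs a gap `g`, depending on the required accuracy, such that

* shifting the arguments of the joint tail of `(W i, V j)` by `g` changes it only by a factor near
  one. For consistently varying tails `g(x) = (1 - z) x` with `z` close to one, and the property
  passes from `(X i, Y j)` to `(W i, V j)` by integration (`BoundedWeights.jointReal_mul_le`). For
  long tails `g` is a constant; here small weights magnify the shift, but they are improbable, and
  by dominated variation their contribution is of the order of their probability
  (`BoundedWeights.jointReal_sub_le`);
* two jumps in one sequence, the second one at level `g / n`, together with a jump in the other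
  sequence are negligible (`HalfGQAI.coexceed_le`, `HalfGTAI.coexceed_le`). Boundedness reduces this
  to the dependence assumption on `X` and `Y`, and dominated variation bounds the joint tails of
  `(X i, Y j)` by those of `(W i, V j)` (`BoundedWeights.jointReal_scale_le`). The latter fails only
  if `Θ i` and `Δ j` are almost surely never positive together, but then the event is null.
-/

namespace HeavyTail

variable {Ω : Type*} [MeasurableSpace Ω] {P : Measure Ω}

/-! ### Joint tails as real numbers -/

/-- The joint tail `P[X > x, Y > y]` as a real-valued function of the pair `(x, y)`. -/
noncomputable def jointReal (P : Measure Ω) (X Y : Ω → ℝ) (p : ℝ × ℝ) : ℝ :=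
  P.real {ω | p.1 < X ω ∧ p.2 < Y ω}

lemma jointReal_nonneg (X Y : Ω → ℝ) (p : ℝ × ℝ) : 0 ≤ jointReal P X Y p :=
  measureReal_nonneg

lemma jointReal_anti [IsFiniteMeasure P] (X Y : Ω → ℝ) {p q : ℝ × ℝ} (h1 : q.1 ≤ p.1)
    (h2 : q.2 ≤ p.2) : jointReal P X Y p ≤ jointReal P X Y q :=
  measureReal_mono fun _ h => ⟨h1.trans_lt h.1, h2.trans_lt h.2⟩

lemma jointReal_swap (X Y : Ω → ℝ) (p : ℝ × ℝ) :
    jointReal P Y X p.swap = jointReal P X Y p := by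
  unfold jointReal
  congr 1
  ext ω
  exact and_comm

lemma eventually_pos_prod : ∀ᶠ p : ℝ × ℝ in atTop ×ˢ atTop, 0 < p.1 ∧ 0 < p.2 :=
  (eventually_gt_atTop 0).prod_mk (eventually_gt_atTop 0)

/-- The probability that `Z` is large in absolute value (beyond `u`) while `X > s` and `Y > t`. -/
noncomputable def coexceed (P : Measure Ω) (Z X Y : Ω → ℝ) (u s t : ℝ) : ℝ :=
  P.real {ω | u < |Z ω| ∧ s < X ω ∧ t < Y ω}

lemma coexceed_nonneg (Z X Y : Ω → ℝ) (u s t : ℝ) : 0 ≤ coexceed P Z X Y u s t :=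
  measureReal_nonneg

lemma jointReal_le_doubleSum {n m : ℕ} (X : Fin n → Ω → ℝ) (Y : Fin m → Ω → ℝ)
    (Θ : Fin n → Ω → ℝ) (Δ : Fin m → Ω → ℝ) (p : ℝ × ℝ) (i : Fin n) (j : Fin m) :
    jointReal P (fun ω => Θ i ω * X i ω) (fun ω => Δ j ω * Y j ω) p
      ≤ doubleSum P X Y Θ Δ p := by
  unfold doubleSum jointReal
  refine le_trans ?_ (Finset.single_le_sum (f := fun i => ∑ j,
    P.real {ω | p.1 < Θ i ω * X i ω ∧ p.2 < Δ j ω * Y j ω})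
    (fun i _ => Finset.sum_nonneg fun j _ => measureReal_nonneg) (Finset.mem_univ i))
  exact Finset.single_le_sum (f := fun j =>
    P.real {ω | p.1 < Θ i ω * X i ω ∧ p.2 < Δ j ω * Y j ω})
    (fun j _ => measureReal_nonneg) (Finset.mem_univ j)

/-! ### The principle of a single big jump -/

/-- If a sum of positive parts exceeds `x`, then one summand exceeds `x / n`, and either it exceeds
`x - g` or a second summand is at least of the order of `g`. -/
lemma exists_big_jump {n : ℕ} (w : Fin n → ℝ) {x g : ℝ} (hx : 0 < x) (hg : 0 ≤ g)
    (h : x < ∑ i, max (w i) 0) :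
    ∃ i, x / n < w i ∧ (x - g < w i ∨ ∃ k, k ≠ i ∧ g / n < |w k|) := by
  have hn : 0 < (n : ℝ) := by
    rcases Nat.eq_zero_or_pos n with rfl | hn
    · simp at h
      linarith
    · exact_mod_cast hn
  obtain ⟨i, hi⟩ : ∃ i, x / n < max (w i) 0 := by
    by_contra! hcon
    have := Finset.sum_le_sum fun i (_ : i ∈ Finset.univ) => hcon i
    simp only [Finset.sum_const, Finset.card_univ, Fintype.card_fin, nsmul_eq_mul] at this
    rw [mul_div_cancel₀ _ hn.ne'] at this
    linarith
  have hxn : 0 < x / n := by positivity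
  have hwi : x / n < w i := (lt_max_iff.1 hi).resolve_right (by linarith)
  refine ⟨i, hwi, ?_⟩
  by_contra! hcon
  obtain ⟨h1, h2⟩ := hcon
  have hgn : 0 ≤ g / n := by positivity
  have key : ∑ k, max (w k) 0 ≤ ∑ k, (g / n + if k = i then x - g else 0) := by
    refine Finset.sum_le_sum fun k _ => ?_
    split_ifs with hk
    · subst hk
      rw [max_eq_left (by linarith)]
      linarith
    · rw [add_zero]
      exact max_le ((le_abs_self _).trans (h2 k hk)) hgn
  rw [Finset.sum_add_distrib] at key
  simp only [Finset.sum_const, Finset.card_univ, Fintype.card_fin, nsmul_eq_mul,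
    Finset.sum_ite_eq', Finset.mem_univ, if_true] at key
  rw [mul_div_cancel₀ _ hn.ne'] at key
  linarith

section BigJump

variable [IsFiniteMeasure P] {n m : ℕ} (W : Fin n → Ω → ℝ) (V : Fin m → Ω → ℝ)

/-- Total probability of two big jumps in `W` (the second one measured by `g`) together with one
in `V`. -/
noncomputable def twoJumps (P : Measure Ω) {n m : ℕ} (W : Fin n → Ω → ℝ) (V : Fin m → Ω → ℝ)
    (g x y : ℝ) : ℝ :=
  ∑ k, ∑ i, ∑ j, if k ≠ i then coexceed P (W k) (W i) (V j) (g / n) (x / n) (y / m) else 0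

/-- The event of two big jumps in `W` together with one in `V`. -/
def twoJumpsEvent {n m : ℕ} (W : Fin n → Ω → ℝ) (V : Fin m → Ω → ℝ) (g x y : ℝ) : Set Ω :=
  ⋃ k, ⋃ i, ⋃ j, {ω | k ≠ i ∧ g / n < |W k ω| ∧ x / n < W i ω ∧ y / m < V j ω}

lemma measureReal_twoJumpsEvent_le (g x y : ℝ) :
    P.real (twoJumpsEvent W V g x y) ≤ twoJumps P W V g x y := by
  unfold twoJumpsEvent twoJumps
  refine (measureReal_iUnion_fintype_le _).trans (Finset.sum_le_sum fun k _ => ?_)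
  refine (measureReal_iUnion_fintype_le _).trans (Finset.sum_le_sum fun i _ => ?_)
  refine (measureReal_iUnion_fintype_le _).trans (Finset.sum_le_sum fun j _ => ?_)
  split_ifs with hki
  · exact measureReal_mono fun ω h => h.2
  · simp [hki]

lemma measurableSet_twoJumpsEvent (hW : ∀ i, Measurable (W i)) (hV : ∀ j, Measurable (V j))
    (g x y : ℝ) : MeasurableSet (twoJumpsEvent W V g x y) := by
  refine MeasurableSet.iUnion fun k => MeasurableSet.iUnion fun i => MeasurableSet.iUnion fun j => ?_
  refine (MeasurableSet.const _).inter ?_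
  refine (measurableSet_lt measurable_const (hW k).abs).inter ?_
  exact (measurableSet_lt measurable_const (hW i)).inter (measurableSet_lt measurable_const (hV j))

/-- Upper single-big-jump bound: if `S` and `T` are dominated by the sums of the positive parts,
their joint exceedance requires one jump in each sequence, or an additional second jump. -/
lemma jointReal_le_of_le_sum_max {S T : Ω → ℝ} (hS : ∀ ω, S ω ≤ ∑ i, max (W i ω) 0)
    (hT : ∀ ω, T ω ≤ ∑ j, max (V j ω) 0) {x y g h : ℝ} (hx : 0 < x) (hy : 0 < y) (hg : 0 ≤ g)
    (hh : 0 ≤ h) :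
    jointReal P S T (x, y) ≤ (∑ i, ∑ j, jointReal P (W i) (V j) (x - g, y - h))
      + twoJumps P W V g x y + twoJumps P V W h y x := by
  have hsub : {ω | x < S ω ∧ y < T ω} ⊆
      ((⋃ i, ⋃ j, {ω | x - g < W i ω ∧ y - h < V j ω}) ∪ twoJumpsEvent W V g x y) ∪
        twoJumpsEvent V W h y x := by
    rintro ω ⟨h1, h2⟩
    obtain ⟨i, hi, hi'⟩ := exists_big_jump (fun i => W i ω) hx hg (h1.trans_le (hS ω))
    obtain ⟨j, hj, hj'⟩ := exists_big_jump (fun j => V j ω) hy hh (h2.trans_le (hT ω))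
    simp only [twoJumpsEvent, Set.mem_union, Set.mem_iUnion, Set.mem_ofPred_eq]
    rcases hi' with hi' | ⟨k, hki, hk⟩
    · rcases hj' with hj' | ⟨l, hlj, hl⟩
      · exact Or.inl (Or.inl ⟨i, j, hi', hj'⟩)
      · exact Or.inr ⟨l, j, i, hlj, hl, hj, hi⟩
    · exact Or.inl (Or.inr ⟨k, i, j, hki, hk, hi, hj⟩)
  refine (measureReal_mono hsub).trans ?_
  refine (measureReal_union_le _ _).trans (add_le_add ?_ (measureReal_twoJumpsEvent_le _ _ _ _ _))
  refine (measureReal_union_le _ _).trans (add_le_add ?_ (measureReal_twoJumpsEvent_le _ _ _ _ _))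
  refine (measureReal_iUnion_fintype_le _).trans (Finset.sum_le_sum fun i _ => ?_)
  exact measureReal_iUnion_fintype_le _

/-- Lower single-big-jump bound: outside the event of two big jumps, the events that a given pair
of terms jumps are disjoint, and each of them makes `S` and `T` large. -/
lemma sum_jointReal_le (hW : ∀ i, Measurable (W i)) (hV : ∀ j, Measurable (V j)) {S T : Ω → ℝ}
    {x y g h : ℝ} (hx : 0 < x) (hy : 0 < y) (hg : 0 ≤ g) (hh : 0 ≤ h)
    (hS : ∀ ω i, x + g < W i ω → (∀ k, k ≠ i → |W k ω| ≤ g / n) → x < S ω)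
    (hT : ∀ ω j, y + h < V j ω → (∀ l, l ≠ j → |V l ω| ≤ h / m) → y < T ω) :
    (∑ i, ∑ j, jointReal P (W i) (V j) (x + g, y + h)) ≤ jointReal P S T (x, y)
      + (n * m) * (twoJumps P W V g x y + twoJumps P V W h y x) := by
  set B : Set Ω := twoJumpsEvent W V g x y ∪ twoJumpsEvent V W h y x with hB
  set A : Fin n × Fin m → Set Ω := fun q => {ω | x + g < W q.1 ω ∧ y + h < V q.2 ω} with hA
  have hBm : MeasurableSet B :=
    (measurableSet_twoJumpsEvent W V hW hV _ _ _).union (measurableSet_twoJumpsEvent V W hV hW _ _ _)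
  have hAm : ∀ q, MeasurableSet (A q) := fun q =>
    (measurableSet_lt measurable_const (hW q.1)).inter (measurableSet_lt measurable_const (hV q.2))
  have hn1 : ∀ i : Fin n, (1 : ℝ) ≤ n := fun i => by
    exact_mod_cast Nat.one_le_iff_ne_zero.2 (by rintro rfl; exact i.elim0)
  have hm1 : ∀ j : Fin m, (1 : ℝ) ≤ m := fun j => by
    exact_mod_cast Nat.one_le_iff_ne_zero.2 (by rintro rfl; exact j.elim0)
  -- On `A q \ B` all the other terms are small.
  have hsmall : ∀ q, ∀ ω ∈ A q \ B, (∀ k, k ≠ q.1 → |W k ω| ≤ g / n) ∧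
      (∀ l, l ≠ q.2 → |V l ω| ≤ h / m) := by
    rintro ⟨i, j⟩ ω ⟨⟨h1, h2⟩, h3⟩
    simp only at h1 h2
    have hxi : x / n < W i ω := (div_le_self hx.le (hn1 i)).trans_lt (by linarith)
    have hyj : y / m < V j ω := (div_le_self hy.le (hm1 j)).trans_lt (by linarith)
    simp only [hB, twoJumpsEvent, Set.mem_union, Set.mem_iUnion, Set.mem_ofPred_eq, not_or,
      not_exists] at h3
    refine ⟨fun k hk => ?_, fun l hl => ?_⟩
    · by_contra! hcon
      exact h3.1 k i j ⟨hk, hcon, hxi, hyj⟩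
    · by_contra! hcon
      exact h3.2 l j i ⟨hl, hcon, hyj, hxi⟩
  have hdisj : ((Finset.univ : Finset (Fin n × Fin m)) : Set (Fin n × Fin m)).PairwiseDisjoint
      (fun q => A q \ B) := by
    rintro q - r - hqr
    refine Set.disjoint_left.2 fun ω hq hr => hqr ?_
    obtain ⟨h1, h2⟩ := hsmall q ω hq
    have e1 : r.1 = q.1 := by
      by_contra hne
      have := (le_abs_self _).trans (h1 _ hne)
      have := hr.1.1
      have := div_le_self hg (hn1 q.1)
      linarith
    have e2 : r.2 = q.2 := by
      by_contra hne
      have := (le_abs_self _).trans (h2 _ hne)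
      have := hr.1.2
      have := div_le_self hh (hm1 q.2)
      linarith
    exact (Prod.ext e1 e2).symm
  have hunion : ∑ q, P.real (A q \ B) ≤ jointReal P S T (x, y) := by
    rw [← measureReal_biUnion_finset hdisj fun q _ => (hAm q).diff hBm]
    refine measureReal_mono fun ω hω => ?_
    simp only [Set.mem_iUnion, Finset.mem_univ, exists_prop, true_and] at hω
    obtain ⟨q, hq⟩ := hω
    obtain ⟨h1, h2⟩ := hsmall q ω hq
    exact ⟨hS ω q.1 hq.1.1 h1, hT ω q.2 hq.1.2 h2⟩
  have hPB : P.real B ≤ twoJumps P W V g x y + twoJumps P V W h y x :=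
    (measureReal_union_le _ _).trans (add_le_add (measureReal_twoJumpsEvent_le _ _ _ _ _)
      (measureReal_twoJumpsEvent_le _ _ _ _ _))
  have hsum : (∑ i, ∑ j, jointReal P (W i) (V j) (x + g, y + h)) = ∑ q, P.real (A q) := by
    rw [Fintype.sum_prod_type]
    rfl
  rw [hsum]
  calc ∑ q, P.real (A q) ≤ ∑ q : Fin n × Fin m, (P.real (A q \ B) + P.real B) := by
        refine Finset.sum_le_sum fun q _ => ?_
        refine (measureReal_mono (?_ : A q ⊆ (A q \ B) ∪ B)).trans (measureReal_union_le _ _)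
        rw [Set.sdiff_union_self]
        exact Set.subset_union_left
    _ = ∑ q, P.real (A q \ B) + (n * m) * P.real B := by
        rw [Finset.sum_add_distrib]
        simp
    _ ≤ _ := by gcongr

/-- `S` lies between one big jump and the sum of positive parts: it is at most the sum of the
positive parts of the `W i`, and it exceeds `x` whenever one of them exceeds `x + g` and the others
are at most `g / n` in absolute value. -/
structure JumpFunctional {n : ℕ} (W : Fin n → Ω → ℝ) (S : Ω → ℝ) : Prop where
  le_sum : ∀ ω, S ω ≤ ∑ i, max (W i ω) 0
  lt_of_jump : ∀ ω i x g, 0 ≤ g → x + g < W i ω → (∀ k, k ≠ i → |W k ω| ≤ g / n) → x < S ω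

/-- The abstract form of the theorem. Suppose that for every `ε` there is a gap function `g` which
is negligible for the joint tails of the single terms (shifting the arguments by `g` changes them
by a factor of at most `1 + ε`), but such that two jumps in one sequence, the second one at the
level `g`, are improbable. Then every pair `(S, T)` lying between one big jump and the sum of the
positive parts has the same joint tail as the sum of the single joint tails. -/
lemma isEquivalent_of_gap (hW : ∀ i, Measurable (W i)) (hV : ∀ j, Measurable (V j))
    {D : ℝ × ℝ → ℝ} (hD : ∀ p, D p = ∑ i, ∑ j, jointReal P (W i) (V j) p)
    (hgap : ∀ ε : ℝ, 0 < ε → ∃ g : ℝ → ℝ, (∀ x, 0 ≤ x → 0 ≤ g x) ∧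
      (∀ i j, ∀ᶠ p : ℝ × ℝ in atTop ×ˢ atTop,
        jointReal P (W i) (V j) (p.1 - g p.1, p.2 - g p.2) ≤ (1 + ε) * jointReal P (W i) (V j) p) ∧
      (∀ i j, ∀ᶠ p : ℝ × ℝ in atTop ×ˢ atTop,
        jointReal P (W i) (V j) p ≤ (1 + ε) * jointReal P (W i) (V j) (p.1 + g p.1, p.2 + g p.2)) ∧
      (∀ k i, k ≠ i → ∀ j, ∀ᶠ p : ℝ × ℝ in atTop ×ˢ atTop,
        coexceed P (W k) (W i) (V j) (g p.1 / n) (p.1 / n) (p.2 / m) ≤ ε * D p) ∧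
      (∀ l j, l ≠ j → ∀ i, ∀ᶠ p : ℝ × ℝ in atTop ×ˢ atTop,
        coexceed P (V l) (V j) (W i) (g p.2 / m) (p.2 / m) (p.1 / n) ≤ ε * D p))
    {S T : Ω → ℝ} (hS : JumpFunctional W S) (hT : JumpFunctional V T) :
    jointReal P S T ~[atTop ×ˢ atTop] D := by
  have hD0 : ∀ p, 0 ≤ D p := fun p => by
    rw [hD]
    exact Finset.sum_nonneg fun i _ => Finset.sum_nonneg fun j _ => jointReal_nonneg _ _ _
  set N : ℝ := n * n * m + m * m * n with hN
  have hN0 : 0 ≤ N := by positivity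
  refine isLittleO_iff.2 fun c hc => ?_
  -- The errors of the upper and of the lower bound, respectively, are to be at most `c`.
  obtain ⟨ε, hε, hεc, hεc'⟩ : ∃ ε : ℝ, 0 < ε ∧ ε + N * ε ≤ c ∧ ε + n * m * (N * ε) ≤ c := by
    refine ⟨c / (1 + N + n * m * N), by positivity, ?_, ?_⟩
    · have : c / (1 + N + n * m * N) + N * (c / (1 + N + n * m * N))
          = c * ((1 + N) / (1 + N + n * m * N)) := by ring
      rw [this]
      refine mul_le_of_le_one_right hc.le (div_le_one_of_le₀ ?_ (by positivity))
      have : 0 ≤ n * m * N := by positivity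
      linarith
    · have : c / (1 + N + n * m * N) + n * m * (N * (c / (1 + N + n * m * N)))
          = c * ((1 + n * m * N) / (1 + N + n * m * N)) := by ring
      rw [this]
      exact mul_le_of_le_one_right hc.le (div_le_one_of_le₀ (by linarith) (by positivity))
  obtain ⟨g, hg, hm1, hm2, hb1, hb2⟩ := hgap ε hε
  have hm1' := eventually_all.2 fun i => eventually_all.2 fun j => hm1 i j
  have hm2' := eventually_all.2 fun i => eventually_all.2 fun j => hm2 i j
  have hb1' := eventually_all.2 fun k => eventually_all.2 fun i =>
    eventually_all.2 fun hki => eventually_all.2 fun j => hb1 k i hki j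
  have hb2' := eventually_all.2 fun k => eventually_all.2 fun i =>
    eventually_all.2 fun hki => eventually_all.2 fun j => hb2 k i hki j
  filter_upwards [hm1', hm2', hb1', hb2', eventually_pos_prod] with p h1 h2 h3 h4 h5
  have hg1 := hg p.1 h5.1.le
  have hg2 := hg p.2 h5.2.le
  have J1 : twoJumps P W V (g p.1) p.1 p.2 ≤ n * n * m * (ε * D p) := by
    have : twoJumps P W V (g p.1) p.1 p.2 ≤ ∑ k : Fin n, ∑ i : Fin n, ∑ j : Fin m, ε * D p := by
      refine Finset.sum_le_sum fun k _ => Finset.sum_le_sum fun i _ =>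
        Finset.sum_le_sum fun j _ => ?_
      split_ifs with hki
      · exact h3 k i hki j
      · exact mul_nonneg hε.le (hD0 p)
    refine this.trans (le_of_eq ?_)
    simp
    ring
  have J2 : twoJumps P V W (g p.2) p.2 p.1 ≤ m * m * n * (ε * D p) := by
    have : twoJumps P V W (g p.2) p.2 p.1 ≤ ∑ k : Fin m, ∑ i : Fin m, ∑ j : Fin n, ε * D p := by
      refine Finset.sum_le_sum fun k _ => Finset.sum_le_sum fun i _ =>
        Finset.sum_le_sum fun j _ => ?_
      split_ifs with hki
      · exact h4 k i hki j
      · exact mul_nonneg hε.le (hD0 p)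
    refine this.trans (le_of_eq ?_)
    simp
    ring
  have up := jointReal_le_of_le_sum_max (P := P) W V hS.le_sum hT.le_sum h5.1 h5.2 hg1 hg2
  have lo := sum_jointReal_le (P := P) W V hW hV h5.1 h5.2 hg1 hg2
    (fun ω i => hS.lt_of_jump ω i _ _ hg1) (fun ω j => hT.lt_of_jump ω j _ _ hg2)
  have up' : ∑ i, ∑ j, jointReal P (W i) (V j) (p.1 - g p.1, p.2 - g p.2) ≤ (1 + ε) * D p := by
    rw [hD, Finset.mul_sum]
    simp_rw [Finset.mul_sum]
    exact Finset.sum_le_sum fun i _ => Finset.sum_le_sum fun j _ => h1 i j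
  have lo' : D p ≤
      (∑ i, ∑ j, jointReal P (W i) (V j) (p.1 + g p.1, p.2 + g p.2)) + ε * D p := by
    rw [hD, Finset.mul_sum, ← Finset.sum_add_distrib]
    simp_rw [Finset.mul_sum, ← Finset.sum_add_distrib]
    refine Finset.sum_le_sum fun i _ => Finset.sum_le_sum fun j _ => (h2 i j).trans ?_
    rw [add_mul, one_mul]
    gcongr
    exact jointReal_anti _ _ (by simpa using hg1) (by simpa using hg2)
  have hJ : twoJumps P W V (g p.1) p.1 p.2 + twoJumps P V W (g p.2) p.2 p.1 ≤ N * ε * D p := by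
    rw [hN]
    linarith
  have c1 := mul_le_mul_of_nonneg_right hεc (hD0 p)
  have c2 := mul_le_mul_of_nonneg_right hεc' (hD0 p)
  have hnm : n * m * (twoJumps P W V (g p.1) p.1 p.2 + twoJumps P V W (g p.2) p.2 p.1)
      ≤ n * m * (N * ε * D p) := by gcongr
  rw [Real.norm_eq_abs, Real.norm_of_nonneg (hD0 p), Pi.sub_apply, abs_le]
  constructor
  · linarith
  · linarith

end BigJump

/-! ### Consequences of the bivariate tail classes -/

lemma measureReal_mono_of_ae [IsFiniteMeasure P] {A B : Set Ω} (h : ∀ᵐ ω ∂P, ω ∈ A → ω ∈ B) :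
    P.real A ≤ P.real B :=
  ENNReal.toReal_mono (measure_ne_top _ _) (measure_mono_ae h)

/-- A bound on a ratio of measures gives a bound on real measures, with no positivity assumption:
`a / 0 = ∞` unless `a = 0`. -/
lemma measureReal_le_of_div_le [IsFiniteMeasure P] {A B : Set Ω} {c : ℝ} (hc : 0 ≤ c)
    (h : P A / P B ≤ ENNReal.ofReal c) : P.real A ≤ c * P.real B := by
  have h' : P A ≤ ENNReal.ofReal c * P B :=
    (ENNReal.div_le_iff_le_mul (Or.inr ENNReal.ofReal_ne_top)
      (Or.inl (measure_ne_top P B))).1 h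
  have := ENNReal.toReal_mono (ENNReal.mul_ne_top ENNReal.ofReal_ne_top (measure_ne_top P B)) h'
  rwa [ENNReal.toReal_mul, ENNReal.toReal_ofReal hc] at this

lemma tendsto_mul_atTop_prod {s : ℝ} (hs : 0 < s) :
    Tendsto (fun p : ℝ × ℝ => (s * p.1, s * p.2)) (atTop ×ˢ atTop) (atTop ×ˢ atTop) :=
  (tendsto_id.const_mul_atTop hs).prodMap (tendsto_id.const_mul_atTop hs)

lemma tendsto_add_atTop_prod (a : ℝ) :
    Tendsto (fun p : ℝ × ℝ => (p.1 + a, p.2 + a)) (atTop ×ˢ atTop) (atTop ×ˢ atTop) :=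
  (tendsto_atTop_add_const_right _ a tendsto_id).prodMap
    (tendsto_atTop_add_const_right _ a tendsto_id)

/-- Dominated variation of a joint tail along common scalings of both arguments. -/
def DominatedPair (P : Measure Ω) (X Y : Ω → ℝ) : Prop :=
  ∀ s : ℝ, 0 < s → ∃ C : ℝ, 0 < C ∧ ∀ᶠ p : ℝ × ℝ in atTop ×ˢ atTop,
    jointReal P X Y (s * p.1, s * p.2) ≤ C * jointReal P X Y p

/-- Only scalings by numbers below one matter for dominated variation. -/
lemma DominatedPair.of_lt_one [IsFiniteMeasure P] {X Y : Ω → ℝ}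
    (h : ∀ s : ℝ, 0 < s → s < 1 → ∃ C : ℝ, 0 < C ∧ ∀ᶠ p : ℝ × ℝ in atTop ×ˢ atTop,
      jointReal P X Y (s * p.1, s * p.2) ≤ C * jointReal P X Y p) : DominatedPair P X Y := by
  intro s hs
  rcases lt_or_ge s 1 with h1 | h1
  · exact h s hs h1
  · refine ⟨1, one_pos, ?_⟩
    filter_upwards [(eventually_ge_atTop (0 : ℝ)).prod_mk (eventually_ge_atTop (0 : ℝ))] with p hp
    rw [one_mul]
    exact jointReal_anti _ _ (le_mul_of_one_le_left hp.1 h1) (le_mul_of_one_le_left hp.2 h1)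

/-- A bivariate consistently varying joint tail is hardly changed by a scaling close to one. -/
lemma ClassC2.eventually_le [IsFiniteMeasure P] {X Y : Ω → ℝ} (h : ClassC2 P X Y) {ε : ℝ}
    (hε : 0 < ε) :
    ∀ᶠ z in 𝓝[<] (1 : ℝ), ∀ᶠ p : ℝ × ℝ in atTop ×ˢ atTop,
      jointReal P X Y (z * p.1, z * p.2) ≤ (1 + ε) * jointReal P X Y p := by
  have hdiag : Tendsto (fun z : ℝ => (z, z)) (𝓝[<] 1) (𝓝[<] 1 ×ˢ 𝓝[<] 1) :=
    tendsto_id.prodMk tendsto_id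
  have hlt : (1 : ℝ≥0∞) < ENNReal.ofReal (1 + ε) := ENNReal.one_lt_ofReal.2 (by linarith)
  filter_upwards [(h.2.2.comp hdiag).eventually_lt_const hlt] with z hz
  filter_upwards [eventually_lt_of_limsup_lt hz] with p hp
  exact measureReal_le_of_div_le (by linarith) hp.le

lemma ClassC2.dominatedPair [IsFiniteMeasure P] {X Y : Ω → ℝ} (h : ClassC2 P X Y) :
    DominatedPair P X Y := by
  have hnear : ∀ᶠ z in 𝓝[<] (1 : ℝ), z ∈ Set.Ioo (0 : ℝ) 1 := Ioo_mem_nhdsLT one_pos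
  obtain ⟨z, hz, hz0, hz1⟩ := ((h.eventually_le one_pos).and hnear).exists
  -- Iterating the bound for one scaling `z < 1` reaches every scaling.
  have hpow : ∀ k : ℕ, ∀ᶠ p : ℝ × ℝ in atTop ×ˢ atTop,
      jointReal P X Y (z ^ k * p.1, z ^ k * p.2) ≤ (1 + 1) ^ k * jointReal P X Y p := by
    intro k
    induction k with
    | zero => simp
    | succ k ih =>
      filter_upwards [ih, (tendsto_mul_atTop_prod (pow_pos hz0 k)).eventually hz] with p h1 h2
      simp only [← mul_assoc, ← pow_succ'] at h2
      calc _ ≤ _ := h2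
        _ ≤ (1 + 1) * ((1 + 1) ^ k * jointReal P X Y p) := by gcongr
        _ = _ := by ring
  refine DominatedPair.of_lt_one fun s hs _ => ?_
  obtain ⟨k, hk⟩ := exists_pow_lt_of_lt_one hs hz1
  refine ⟨(1 + 1) ^ k, by positivity, ?_⟩
  filter_upwards [hpow k, (eventually_ge_atTop (0 : ℝ)).prod_mk (eventually_ge_atTop (0 : ℝ))]
    with p h1 hp
  exact (jointReal_anti _ _ (mul_le_mul_of_nonneg_right hk.le hp.1)
    (mul_le_mul_of_nonneg_right hk.le hp.2)).trans h1

lemma ClassD2.dominatedPair [IsFiniteMeasure P] {X Y : Ω → ℝ} (h : ClassD2 P X Y) :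
    DominatedPair P X Y := by
  refine DominatedPair.of_lt_one fun s hs hs1 => ?_
  obtain ⟨c, hc, hc'⟩ := exists_between (h.2.2.2 s s hs hs1 hs hs1)
  refine ⟨c.toReal + 1, by positivity, ?_⟩
  filter_upwards [eventually_lt_of_limsup_lt hc] with p hp
  refine measureReal_le_of_div_le (by positivity) (hp.le.trans ?_)
  rw [← ENNReal.ofReal_toReal hc'.ne]
  exact ENNReal.ofReal_le_ofReal (by simp)

lemma ClassL2.eventually_le [IsFiniteMeasure P] {X Y : Ω → ℝ} (h : ClassL2 P X Y) {ε a : ℝ}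
    (hε : 0 < ε) (ha : 0 < a) :
    ∀ᶠ p : ℝ × ℝ in atTop ×ˢ atTop,
      jointReal P X Y (p.1 - a, p.2 - a) ≤ (1 + ε) * jointReal P X Y p := by
  have hlt : (1 : ℝ≥0∞) < ENNReal.ofReal (1 + ε) := ENNReal.one_lt_ofReal.2 (by linarith)
  filter_upwards [(h.2.2 a a ha.le ha.le (by simp [ha.ne'])).eventually_lt_const hlt] with p hp
  exact measureReal_le_of_div_le (by linarith) hp.le

/-! ### Bounded weights -/

/-- An inequality between the conditional probabilities of two events, given one of two independent
random elements, integrates to an inequality between their probabilities. -/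
lemma measureReal_le_mul_of_indepFun [IsFiniteMeasure P] {α β : Type*} [MeasurableSpace α]
    [MeasurableSpace β] {U : Ω → α} {V : Ω → β} (hU : Measurable U) (hV : Measurable V)
    (hind : IndepFun U V P) {A B : Set (α × β)} (hA : MeasurableSet A) (hB : MeasurableSet B)
    {c : ℝ} (hc : 0 ≤ c)
    (h : ∀ᵐ ω ∂P, P.real {ω' | (U ω, V ω') ∈ A} ≤ c * P.real {ω' | (U ω, V ω') ∈ B}) :
    P.real {ω | (U ω, V ω) ∈ A} ≤ c * P.real {ω | (U ω, V ω) ∈ B} := by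
  have hdis : ∀ {E : Set (α × β)}, MeasurableSet E →
      P {ω | (U ω, V ω) ∈ E} = ∫⁻ ω, P {ω' | (U ω, V ω') ∈ E} ∂P := by
    intro E hE
    have h1 := (indepFun_iff_map_prod_eq_prod_map_map hU.aemeasurable hV.aemeasurable).1 hind
    have h2 : P {ω | (U ω, V ω) ∈ E} = Measure.map (fun ω => (U ω, V ω)) P E :=
      (Measure.map_apply (hU.prodMk hV) hE).symm
    rw [h2, h1, Measure.prod_apply hE, lintegral_map (measurable_measure_prodMk_left hE) hU]
    refine lintegral_congr fun ω => ?_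
    rw [Measure.map_apply hV (measurable_prodMk_left hE)]
    rfl
  have hmain : P {ω | (U ω, V ω) ∈ A} ≤ ENNReal.ofReal c * P {ω | (U ω, V ω) ∈ B} := by
    rw [hdis hA, hdis hB, ← lintegral_const_mul' _ _ ENNReal.ofReal_ne_top]
    refine lintegral_mono_ae ?_
    filter_upwards [h] with ω hω
    rw [← ofReal_measureReal, ← ofReal_measureReal, ← ENNReal.ofReal_mul hc]
    exact ENNReal.ofReal_le_ofReal hω
  have := ENNReal.toReal_mono (ENNReal.mul_ne_top ENNReal.ofReal_ne_top (measure_ne_top P _)) hmain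
  rwa [ENNReal.toReal_mul, ENNReal.toReal_ofReal hc] at this

lemma measurableSet_weighted (s t : ℝ) :
    MeasurableSet {q : (ℝ × ℝ) × (ℝ × ℝ) | s < q.1.1 * q.2.1 ∧ t < q.1.2 * q.2.2} :=
  (measurableSet_lt measurable_const ((measurable_fst.comp measurable_fst).mul
    (measurable_fst.comp measurable_snd))).inter
  (measurableSet_lt measurable_const ((measurable_snd.comp measurable_fst).mul
    (measurable_snd.comp measurable_snd)))

lemma le_div_of_mul_le {K M t x : ℝ} (hx : 0 ≤ x) (h : K * M ≤ x) (ht : 0 < t) (htK : t ≤ K) :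
    M ≤ x / t := by
  rw [le_div_iff₀' ht]
  rcases le_total 0 M with hM | hM
  · exact (mul_le_mul_of_nonneg_right htK hM).trans h
  · exact (mul_nonpos_of_nonneg_of_nonpos ht.le hM).trans hx

/-- A product with a factor in `[0, K]` is large only if this factor is positive and the other
factor is large. -/
lemma pos_and_div_lt_of_lt_mul {K t x s : ℝ} (h0 : 0 ≤ t) (hK : t ≤ K) (hs : 0 ≤ s)
    (h : s < t * x) : 0 < t ∧ s / K < x := by
  have ht : 0 < t := h0.lt_of_ne' fun h0 => by
    rw [h0, zero_mul] at h
    linarith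
  have hx : 0 < x := by
    by_contra! hx
    nlinarith
  refine ⟨ht, ?_⟩
  rw [div_lt_iff₀' (ht.trans_le hK)]
  exact h.trans_le (by gcongr)

/-- It is improbable that two positive weights are not both bounded away from zero. -/
lemma exists_measureReal_small_weights [IsFiniteMeasure P] {Θ Δ : Ω → ℝ} (hΘ : Measurable Θ)
    (hΔ : Measurable Δ) {ε : ℝ} (hε : 0 < ε) : ∃ η : ℝ, 0 < η ∧
      P.real {ω | (0 < Θ ω ∧ 0 < Δ ω) ∧ (Θ ω ≤ η ∨ Δ ω ≤ η)} ≤ ε := by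
  set s : ℕ → Set Ω := fun k => {ω | (0 < Θ ω ∧ 0 < Δ ω) ∧
    (Θ ω ≤ 1 / ((k : ℝ) + 1) ∨ Δ ω ≤ 1 / ((k : ℝ) + 1))} with hs
  have hmeas : ∀ k, MeasurableSet (s k) := fun k =>
    ((measurableSet_lt measurable_const hΘ).inter (measurableSet_lt measurable_const hΔ)).inter
    ((measurableSet_le hΘ measurable_const).union (measurableSet_le hΔ measurable_const))
  have hanti : Antitone s := by
    intro k l hkl ω hω
    have hle : 1 / ((l : ℝ) + 1) ≤ 1 / ((k : ℝ) + 1) := Nat.one_div_le_one_div hkl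
    exact ⟨hω.1, hω.2.imp (fun h => h.trans hle) fun h => h.trans hle⟩
  have hempty : ⋂ k, s k = ∅ := by
    refine Set.eq_empty_of_forall_notMem fun ω hω => ?_
    have hω0 := (Set.mem_iInter.1 hω 0).1
    obtain ⟨k, hk⟩ := exists_nat_one_div_lt (lt_min hω0.1 hω0.2)
    rcases (Set.mem_iInter.1 hω k).2 with h | h
    · exact absurd (hk.trans_le (min_le_left _ _)) (not_lt.2 h)
    · exact absurd (hk.trans_le (min_le_right _ _)) (not_lt.2 h)
  have hlim := tendsto_measure_iInter_atTop (μ := P) (fun k => (hmeas k).nullMeasurableSet) hanti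
    ⟨0, measure_ne_top _ _⟩
  rw [hempty, measure_empty] at hlim
  obtain ⟨k, hk⟩ := (hlim.eventually_lt_const (ENNReal.ofReal_pos.2 hε)).exists
  refine ⟨1 / ((k : ℝ) + 1), by positivity, ?_⟩
  exact (ENNReal.toReal_mono ENNReal.ofReal_ne_top hk.le).trans_eq (ENNReal.toReal_ofReal hε.le)

/-- Non-negative weights `Θ, Δ` that are bounded by `K` and independent of the pair `X, Y`. -/
structure BoundedWeights (P : Measure Ω) (Θ Δ X Y : Ω → ℝ) (K : ℝ) : Prop where
  measurable_left_weight : Measurable Θ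
  measurable_right_weight : Measurable Δ
  measurable_left : Measurable X
  measurable_right : Measurable Y
  indep : IndepFun (fun ω => (Θ ω, Δ ω)) (fun ω => (X ω, Y ω)) P
  left_mem : ∀ᵐ ω ∂P, 0 ≤ Θ ω ∧ Θ ω ≤ K
  right_mem : ∀ᵐ ω ∂P, 0 ≤ Δ ω ∧ Δ ω ≤ K
  bound_pos : 0 < K

namespace BoundedWeights

variable [IsProbabilityMeasure P] {Θ Δ X Y : Ω → ℝ} {K : ℝ}

/-- Unless the weights have almost surely disjoint supports, weighting a pair with a dominatedly
varying joint tail does not decrease the order of the joint tail. -/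
lemma jointReal_scale_le (hw : BoundedWeights P Θ Δ X Y K) (hdom : DominatedPair P X Y)
    (hact : P {ω | 0 < Θ ω ∧ 0 < Δ ω} ≠ 0) {s : ℝ} (hs : 0 < s) :
    ∃ C : ℝ, 0 < C ∧ ∀ᶠ p : ℝ × ℝ in atTop ×ˢ atTop, jointReal P X Y (s * p.1, s * p.2) ≤
      C * jointReal P (fun ω => Θ ω * X ω) (fun ω => Δ ω * Y ω) p := by
  obtain ⟨η, hη, hq⟩ : ∃ η : ℝ, 0 < η ∧ 0 < P.real {ω | η < Θ ω ∧ η < Δ ω} := by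
    by_contra! hcon
    refine hact (measure_mono_null (t := ⋃ k : ℕ, {ω | 1 / ((k : ℝ) + 1) < Θ ω ∧
      1 / ((k : ℝ) + 1) < Δ ω}) (fun ω hω => ?_) (measure_iUnion_null fun k => ?_))
    · obtain ⟨k, hk⟩ := exists_nat_one_div_lt (lt_min hω.1 hω.2)
      exact Set.mem_iUnion.2 ⟨k, hk.trans_le (min_le_left _ _), hk.trans_le (min_le_right _ _)⟩
    · exact (measureReal_eq_zero_iff).1
        (le_antisymm (hcon _ (by positivity)) measureReal_nonneg)
  obtain ⟨C, hC, hCp⟩ := hdom (s * η) (by positivity)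
  set q := P.real {ω | η < Θ ω ∧ η < Δ ω} with hqdef
  refine ⟨C / q, by positivity, ?_⟩
  filter_upwards [(tendsto_mul_atTop_prod (inv_pos.2 hη)).eventually hCp,
    (eventually_ge_atTop (0 : ℝ)).prod_mk (eventually_ge_atTop (0 : ℝ))] with p h1 hp
  have e : ∀ x, s * η * (η⁻¹ * x) = s * x := fun x => by field_simp
  simp only [e] at h1
  have h2 : q * jointReal P X Y (η⁻¹ * p.1, η⁻¹ * p.2) ≤
      jointReal P (fun ω => Θ ω * X ω) (fun ω => Δ ω * Y ω) p := by
    have := hw.indep.measure_inter_preimage_eq_mul (Set.Ioi η ×ˢ Set.Ioi η)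
      (Set.Ioi (η⁻¹ * p.1) ×ˢ Set.Ioi (η⁻¹ * p.2)) (measurableSet_Ioi.prod measurableSet_Ioi)
      (measurableSet_Ioi.prod measurableSet_Ioi)
    have h3 : q * jointReal P X Y (η⁻¹ * p.1, η⁻¹ * p.2) = P.real
        ((fun ω => (Θ ω, Δ ω)) ⁻¹' (Set.Ioi η ×ˢ Set.Ioi η) ∩ (fun ω => (X ω, Y ω)) ⁻¹'
          (Set.Ioi (η⁻¹ * p.1) ×ˢ Set.Ioi (η⁻¹ * p.2))) := by
      rw [measureReal_def, this, ENNReal.toReal_mul]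
      rfl
    rw [h3]
    refine measureReal_mono ?_
    have key : ∀ {t u x : ℝ}, 0 ≤ x → η < t → η⁻¹ * x < u → x < t * u := by
      intro t u x hx ht hu
      have hx' : 0 ≤ η⁻¹ * x := by positivity
      calc x = η * (η⁻¹ * x) := by field_simp
        _ < η * u := by gcongr
        _ ≤ t * u := by gcongr; exact hx'.trans hu.le
    rintro ω ⟨⟨a1, a2⟩, ⟨b1, b2⟩⟩
    exact ⟨key hp.1 a1 b1, key hp.2 a2 b2⟩
  calc _ ≤ _ := h1
    _ = C / q * (q * jointReal P X Y (η⁻¹ * p.1, η⁻¹ * p.2)) := by field_simp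
    _ ≤ _ := by gcongr

/-- If the weights have almost surely disjoint supports, the weighted joint tail vanishes. -/
lemma jointReal_eq_zero (hw : BoundedWeights P Θ Δ X Y K)
    (hact : P {ω | 0 < Θ ω ∧ 0 < Δ ω} = 0) {p : ℝ × ℝ} (h1 : 0 ≤ p.1) (h2 : 0 ≤ p.2) :
    jointReal P (fun ω => Θ ω * X ω) (fun ω => Δ ω * Y ω) p = 0 := by
  unfold jointReal
  rw [measureReal_eq_zero_iff]
  have hae : ∀ᵐ ω ∂P, ¬ (0 < Θ ω ∧ 0 < Δ ω) := by
    rw [ae_iff]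
    simpa using hact
  suffices hnot : ∀ᵐ ω ∂P, ¬ (p.1 < Θ ω * X ω ∧ p.2 < Δ ω * Y ω) by
    rw [ae_iff] at hnot
    simpa using hnot
  filter_upwards [hae, hw.left_mem, hw.right_mem] with ω a b c d
  refine a ⟨b.1.lt_of_ne' fun h0 => ?_, c.1.lt_of_ne' fun h0 => ?_⟩
  · have := d.1
    rw [h0] at this
    linarith
  · have := d.2
    rw [h0] at this
    linarith

/-- Weighted pairs inherit insensitivity to a scaling. -/
lemma jointReal_mul_le (hw : BoundedWeights P Θ Δ X Y K) {z c : ℝ} (hz : 0 < z) (hc : 0 ≤ c)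
    (h : ∀ᶠ p : ℝ × ℝ in atTop ×ˢ atTop,
      jointReal P X Y (z * p.1, z * p.2) ≤ c * jointReal P X Y p) :
    ∀ᶠ p : ℝ × ℝ in atTop ×ˢ atTop,
      jointReal P (fun ω => Θ ω * X ω) (fun ω => Δ ω * Y ω) (z * p.1, z * p.2) ≤
        c * jointReal P (fun ω => Θ ω * X ω) (fun ω => Δ ω * Y ω) p := by
  obtain ⟨M, hM⟩ : ∃ M : ℝ × ℝ, ∀ p ≥ M, jointReal P X Y (z * p.1, z * p.2) ≤
      c * jointReal P X Y p := by
    rw [prod_atTop_atTop_eq] at h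
    exact eventually_atTop.1 h
  filter_upwards [(eventually_ge_atTop (max 0 (K * M.1))).prod_mk
    (eventually_ge_atTop (max 0 (K * M.2)))] with p hp
  have hp1 := le_trans (le_max_left _ _) hp.1
  have hp2 := le_trans (le_max_left _ _) hp.2
  have hp3 := le_trans (le_max_right _ _) hp.1
  have hp4 := le_trans (le_max_right _ _) hp.2
  refine measureReal_le_mul_of_indepFun (U := fun ω => (Θ ω, Δ ω)) (V := fun ω => (X ω, Y ω))
    (A := {q | z * p.1 < q.1.1 * q.2.1 ∧ z * p.2 < q.1.2 * q.2.2})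
    (B := {q | p.1 < q.1.1 * q.2.1 ∧ p.2 < q.1.2 * q.2.2})
    (hw.measurable_left_weight.prodMk hw.measurable_right_weight)
    (hw.measurable_left.prodMk hw.measurable_right) hw.indep
    (measurableSet_weighted _ _) (measurableSet_weighted _ _) hc ?_
  filter_upwards [hw.left_mem, hw.right_mem] with ω h1 h2
  rcases h1.1.eq_or_lt with h0 | ht
  · have : ∀ x y, ¬ (z * p.1 < Θ ω * x ∧ z * p.2 < Δ ω * y) := fun x y hxy => by
      have := hxy.1
      rw [← h0, zero_mul] at this
      nlinarith [mul_nonneg hz.le hp1]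
    simp only [this]
    simpa using mul_nonneg hc measureReal_nonneg
  rcases h2.1.eq_or_lt with h0 | hd
  · have : ∀ x y, ¬ (z * p.1 < Θ ω * x ∧ z * p.2 < Δ ω * y) := fun x y hxy => by
      have := hxy.2
      rw [← h0, zero_mul] at this
      nlinarith [mul_nonneg hz.le hp2]
    simp only [this]
    simpa using mul_nonneg hc measureReal_nonneg
  have hq := hM (p.1 / Θ ω, p.2 / Δ ω)
    ⟨le_div_of_mul_le hp1 hp3 ht h1.2, le_div_of_mul_le hp2 hp4 hd h2.2⟩
  unfold jointReal at hq
  simp only [div_lt_iff₀' ht, div_lt_iff₀' hd, ← mul_div_assoc] at hq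
  exact hq

/-- Weighted pairs inherit insensitivity to a shift. Small weights, which magnify the shift, are
improbable and contribute little because the joint tail is dominatedly varying. -/
lemma jointReal_sub_le (hw : BoundedWeights P Θ Δ X Y K) (hdom : DominatedPair P X Y)
    (h : ∀ ε a : ℝ, 0 < ε → 0 < a → ∀ᶠ p : ℝ × ℝ in atTop ×ˢ atTop,
      jointReal P X Y (p.1 - a, p.2 - a) ≤ (1 + ε) * jointReal P X Y p) {ε a : ℝ} (hε : 0 < ε)
    (ha : 0 < a) :
    ∀ᶠ p : ℝ × ℝ in atTop ×ˢ atTop,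
      jointReal P (fun ω => Θ ω * X ω) (fun ω => Δ ω * Y ω) (p.1 - a, p.2 - a) ≤
        (1 + ε) * jointReal P (fun ω => Θ ω * X ω) (fun ω => Δ ω * Y ω) p := by
  by_cases hact : P {ω | 0 < Θ ω ∧ 0 < Δ ω} = 0
  · filter_upwards [(eventually_ge_atTop a).prod_mk (eventually_ge_atTop a)] with p hp
    rw [hw.jointReal_eq_zero hact (sub_nonneg.2 hp.1) (sub_nonneg.2 hp.2)]
    exact mul_nonneg (by linarith) (jointReal_nonneg _ _ _)
  have hK := hw.bound_pos
  obtain ⟨C, hC, hCp⟩ := hw.jointReal_scale_le hdom hact (s := 1 / (2 * K)) (by positivity)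
  obtain ⟨η, hη, hE⟩ := exists_measureReal_small_weights hw.measurable_left_weight
    hw.measurable_right_weight (ε := ε / 2 / C) (P := P) (by positivity)
  obtain ⟨M, hM⟩ : ∃ M : ℝ × ℝ, ∀ p ≥ M, jointReal P X Y (p.1 - a / η, p.2 - a / η) ≤
      (1 + ε / 2) * jointReal P X Y p := by
    have h' := h (ε / 2) (a / η) (by positivity) (by positivity)
    rw [prod_atTop_atTop_eq] at h'
    exact eventually_atTop.1 h'
  filter_upwards [hCp, (eventually_ge_atTop (max (2 * a) (K * M.1))).prod_mk
    (eventually_ge_atTop (max (2 * a) (K * M.2)))] with p hCp' hp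
  have hp1 := le_trans (le_max_left _ _) hp.1
  have hp2 := le_trans (le_max_left _ _) hp.2
  have hp3 := le_trans (le_max_right _ _) hp.1
  have hp4 := le_trans (le_max_right _ _) hp.2
  -- `G`: both weights exceed `η`, and shifts by `a` become shifts by at most `a / η`.
  -- `F`: some weight is at most `η`, and still `X` and `Y` are large.
  set G : Set Ω := {ω | (η < Θ ω ∧ η < Δ ω) ∧ p.1 - a < Θ ω * X ω ∧ p.2 - a < Δ ω * Y ω}
  set E : Set (ℝ × ℝ) := {u | (0 < u.1 ∧ 0 < u.2) ∧ (u.1 ≤ η ∨ u.2 ≤ η)}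
  set F : Set Ω := (fun ω => (Θ ω, Δ ω)) ⁻¹' E ∩ (fun ω => (X ω, Y ω)) ⁻¹'
    (Set.Ioi (1 / (2 * K) * p.1) ×ˢ Set.Ioi (1 / (2 * K) * p.2))
  have hEm : MeasurableSet E :=
    ((measurableSet_lt measurable_const measurable_fst).inter
      (measurableSet_lt measurable_const measurable_snd)).inter
    ((measurableSet_le measurable_fst measurable_const).union
      (measurableSet_le measurable_snd measurable_const))
  have hsplit : jointReal P (fun ω => Θ ω * X ω) (fun ω => Δ ω * Y ω) (p.1 - a, p.2 - a) ≤
      P.real G + P.real F := by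
    refine le_trans ?_ (measureReal_union_le _ _)
    refine measureReal_mono_of_ae ?_
    filter_upwards [hw.left_mem, hw.right_mem] with ω h1 h2 h3
    obtain ⟨h3, h4⟩ : p.1 - a < Θ ω * X ω ∧ p.2 - a < Δ ω * Y ω := h3
    have key : ∀ {t u x : ℝ}, 2 * a ≤ x → 0 ≤ t → t ≤ K → x - a < t * u →
        0 < t ∧ 1 / (2 * K) * x < u := by
      intro t u x hx h0 htK hlt
      obtain ⟨ht, hu⟩ := pos_and_div_lt_of_lt_mul h0 htK (by linarith) hlt
      refine ⟨ht, lt_of_le_of_lt ?_ hu⟩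
      calc 1 / (2 * K) * x = x / 2 / K := by ring
        _ ≤ (x - a) / K := by gcongr; linarith
    obtain ⟨t1, x1⟩ := key hp1 h1.1 h1.2 h3
    obtain ⟨t2, x2⟩ := key hp2 h2.1 h2.2 h4
    by_cases hgood : η < Θ ω ∧ η < Δ ω
    · exact Or.inl ⟨hgood, h3, h4⟩
    · rw [not_and_or, not_lt, not_lt] at hgood
      exact Or.inr ⟨⟨⟨t1, t2⟩, hgood⟩, x1, x2⟩
  have hF : P.real F ≤ ε / 2 * jointReal P (fun ω => Θ ω * X ω) (fun ω => Δ ω * Y ω) p := by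
    have h1 : P.real F = P.real ((fun ω => (Θ ω, Δ ω)) ⁻¹' E) *
        jointReal P X Y (1 / (2 * K) * p.1, 1 / (2 * K) * p.2) := by
      rw [measureReal_def, hw.indep.measure_inter_preimage_eq_mul _ _ hEm
        (measurableSet_Ioi.prod measurableSet_Ioi), ENNReal.toReal_mul]
      rfl
    rw [h1]
    calc _ ≤ ε / 2 / C *
          (C * jointReal P (fun ω => Θ ω * X ω) (fun ω => Δ ω * Y ω) p) :=
          mul_le_mul hE hCp' (jointReal_nonneg _ _ _) (by positivity)
      _ = _ := by field_simp
  have hG : P.real G ≤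
      (1 + ε / 2) * jointReal P (fun ω => Θ ω * X ω) (fun ω => Δ ω * Y ω) p := by
    refine measureReal_le_mul_of_indepFun (U := fun ω => (Θ ω, Δ ω)) (V := fun ω => (X ω, Y ω))
      (A := {q | (η < q.1.1 ∧ η < q.1.2) ∧ p.1 - a < q.1.1 * q.2.1 ∧ p.2 - a < q.1.2 * q.2.2})
      (B := {q | p.1 < q.1.1 * q.2.1 ∧ p.2 < q.1.2 * q.2.2})
      (hw.measurable_left_weight.prodMk hw.measurable_right_weight)
      (hw.measurable_left.prodMk hw.measurable_right) hw.indep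
      (MeasurableSet.inter ?_ (measurableSet_weighted _ _)) (measurableSet_weighted _ _)
      (by positivity) ?_
    · exact (measurableSet_lt measurable_const (measurable_fst.comp measurable_fst)).inter
        (measurableSet_lt measurable_const (measurable_snd.comp measurable_fst))
    filter_upwards [hw.left_mem, hw.right_mem] with ω h1 h2
    by_cases hgood : η < Θ ω ∧ η < Δ ω
    · have ht := hη.trans hgood.1
      have hd := hη.trans hgood.2
      have hq := hM (p.1 / Θ ω, p.2 / Δ ω) ⟨le_div_of_mul_le (by linarith) hp3 ht h1.2,
        le_div_of_mul_le (by linarith) hp4 hd h2.2⟩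
      refine le_trans (measureReal_mono ?_) (hq.trans_eq ?_)
      · rintro ω' ⟨-, h3, h4⟩
        have key : ∀ {t u x : ℝ}, η < t → x - a < t * u → x / t - a / η < u := by
          intro t u x ht hlt
          have ht0 := hη.trans ht
          have h5 : a / t ≤ a / η := by gcongr
          have h6 : (x - a) / t < u := by rwa [div_lt_iff₀' ht0]
          rw [sub_div] at h6
          linarith
        exact ⟨key hgood.1 h3, key hgood.2 h4⟩
      · unfold jointReal
        simp only [div_lt_iff₀' ht, div_lt_iff₀' hd]
    · simp only [hgood, false_and]
      simpa using mul_nonneg (by positivity) measureReal_nonneg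
  linarith

end BoundedWeights

/-! ### Boundedness of the weights -/

lemma nonpos_of_forall_le_measureReal [IsFiniteMeasure P] {Z : Ω → ℝ} (hZ : Measurable Z) {c : ℝ}
    (h : ∀ y : ℝ, c ≤ P.real {ω | y < Z ω}) : c ≤ 0 := by
  have hlim := tendsto_measure_iInter_atTop (μ := P) (s := fun k : ℕ => {ω | (k : ℝ) < Z ω})
    (fun k => (measurableSet_lt measurable_const hZ).nullMeasurableSet)
    (fun k l hkl ω (hω : (l : ℝ) < Z ω) => lt_of_le_of_lt (Nat.cast_le.2 hkl) hω) ⟨0, measure_ne_top _ _⟩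
  have hempty : ⋂ k : ℕ, {ω | (k : ℝ) < Z ω} = ∅ := by
    refine Set.eq_empty_of_forall_notMem fun ω hω => ?_
    obtain ⟨k, hk⟩ := exists_nat_gt (Z ω)
    exact absurd (Set.mem_iInter.1 hω k) (not_lt.2 hk.le)
  rw [hempty, measure_empty] at hlim
  have hlim' := (ENNReal.tendsto_toReal ENNReal.zero_ne_top).comp hlim
  exact ge_of_tendsto' hlim' fun k => h k

/-- The condition on the weights makes the first one bounded: as the estimate is uniform in `y`,
one may let `y → ∞` for a fixed large `x`, so that `P[Θ > b(x)] = 0`. -/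
lemma WeightCondition.exists_left_le [IsFiniteMeasure P] {Θ Δ X Y : Ω → ℝ}
    (h : WeightCondition P Θ Δ X Y) (hΔ : Measurable Δ) (hY : Measurable Y) :
    ∃ K, ∀ᵐ ω ∂P, Θ ω ≤ K := by
  obtain ⟨⟨b, -, -, -, hb⟩, -⟩ := h
  obtain ⟨x, hx⟩ := (hb.def one_pos).curry.exists
  rw [eventually_top] at hx
  have h0 : P.real {ω | b x < Θ ω} ≤ 0 := by
    refine nonpos_of_forall_le_measureReal (P := P) (hΔ.mul hY) fun y => ?_
    have := hx y
    simp only [Real.norm_eq_abs, abs_of_nonneg (measureReal_nonneg (μ := P)), one_mul] at this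
    exact this.trans (measureReal_mono fun ω hω => hω.2)
  refine ⟨b x, ?_⟩
  rw [ae_iff]
  simpa using (measureReal_eq_zero_iff (μ := P)).1 (le_antisymm h0 measureReal_nonneg)

lemma WeightCondition.swap {Θ Δ X Y : Ω → ℝ} (h : WeightCondition P Θ Δ X Y) :
    WeightCondition P Δ Θ Y X := by
  obtain ⟨⟨b, hb1, hb2, hb3, hb4⟩, c, hc1, hc2, hc3, hc4⟩ := h
  refine ⟨⟨c, hc1, hc2, hc3, ?_⟩, b, hb1, hb2, hb3, ?_⟩
  · refine (hc4.comp_tendsto tendsto_prod_swap).congr (fun _ => rfl) fun p => ?_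
    simp only [Function.comp, Prod.fst_swap, Prod.snd_swap, and_comm]
  · refine (hb4.comp_tendsto tendsto_prod_swap).congr (fun _ => rfl) fun p => ?_
    simp only [Function.comp, Prod.fst_swap, Prod.snd_swap, and_comm]

lemma AdmissibleWeights.exists_boundedWeights [IsProbabilityMeasure P] {n m : ℕ} (hn : 1 ≤ n)
    (hm : 1 ≤ m) {X Θ : Fin n → Ω → ℝ} {Y Δ : Fin m → Ω → ℝ} (hX : ∀ i, Measurable (X i))
    (hY : ∀ j, Measurable (Y j)) (h : AdmissibleWeights P X Y Θ Δ) :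
    ∃ K, ∀ i j, BoundedWeights P (Θ i) (Δ j) (X i) (Y j) K := by
  have hl : ∀ i, ∃ K, ∀ᵐ ω ∂P, Θ i ω ≤ K := fun i =>
    (h.condition i ⟨0, hm⟩).exists_left_le (h.measurable_right _) (hY _)
  have hr : ∀ j, ∃ K, ∀ᵐ ω ∂P, Δ j ω ≤ K := fun j =>
    (h.condition ⟨0, hn⟩ j).swap.exists_left_le (h.measurable_left _) (hX _)
  choose K₁ hK₁ using hl
  choose K₂ hK₂ using hr
  obtain ⟨M₁, hM₁⟩ := Finite.bddAbove_range K₁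
  obtain ⟨M₂, hM₂⟩ := Finite.bddAbove_range K₂
  refine ⟨max 1 (max M₁ M₂), fun i j => ⟨h.measurable_left i, h.measurable_right j, hX i, hY j,
    ?_, ?_, ?_, lt_of_lt_of_le one_pos (le_max_left _ _)⟩⟩
  · exact h.indep.comp (φ := fun q => (q.1 i, q.2 j)) (ψ := fun q => (q.1 i, q.2 j))
      (by fun_prop) (by fun_prop)
  · filter_upwards [h.nonneg_left i, hK₁ i] with ω h1 h2
    exact ⟨h1, h2.trans ((hM₁ ⟨i, rfl⟩).trans ((le_max_left _ _).trans (le_max_right _ _)))⟩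
  · filter_upwards [h.nonneg_right j, hK₂ j] with ω h1 h2
    exact ⟨h1, h2.trans ((hM₂ ⟨j, rfl⟩).trans ((le_max_right _ _).trans (le_max_right _ _)))⟩

/-! ### Improbability of two jumps in one sequence -/

lemma BoundedWeights.swap {Θ Δ X Y : Ω → ℝ} {K : ℝ} (h : BoundedWeights P Θ Δ X Y K) :
    BoundedWeights P Δ Θ Y X K where
  measurable_left_weight := h.measurable_right_weight
  measurable_right_weight := h.measurable_left_weight
  measurable_left := h.measurable_right
  measurable_right := h.measurable_left
  indep := h.indep.comp measurable_swap measurable_swap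
  left_mem := h.right_mem
  right_mem := h.left_mem
  bound_pos := h.bound_pos

lemma DominatedPair.swap {X Y : Ω → ℝ} (h : DominatedPair P X Y) : DominatedPair P Y X := by
  intro s hs
  obtain ⟨C, hC, hp⟩ := h s hs
  refine ⟨C, hC, ?_⟩
  filter_upwards [tendsto_prod_swap.eventually hp] with p hp
  rw [← jointReal_swap, ← jointReal_swap Y X p]
  exact hp

lemma doubleSum_swap {n m : ℕ} (X Θ : Fin n → Ω → ℝ) (Y Δ : Fin m → Ω → ℝ) (p : ℝ × ℝ) :
    doubleSum P Y X Δ Θ p.swap = doubleSum P X Y Θ Δ p := by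
  unfold doubleSum
  rw [Finset.sum_comm]
  simp only [Prod.fst_swap, Prod.snd_swap, and_comm]

lemma coexceed_anti [IsFiniteMeasure P] (Z X Y : Ω → ℝ) {u s t u' s' t' : ℝ} (hu : u' ≤ u)
    (hs : s' ≤ s) (ht : t' ≤ t) : coexceed P Z X Y u s t ≤ coexceed P Z X Y u' s' t' :=
  measureReal_mono fun _ h => ⟨hu.trans_lt h.1, hs.trans_lt h.2.1, ht.trans_lt h.2.2⟩

section TwoJumps

variable [IsProbabilityMeasure P] {n m : ℕ} {X Θ : Fin n → Ω → ℝ} {Y Δ : Fin m → Ω → ℝ} {K : ℝ}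

lemma coexceed_weighted_le (hw : ∀ i j, BoundedWeights P (Θ i) (Δ j) (X i) (Y j) K)
    (k i : Fin n) (j : Fin m) {u s t : ℝ} (hu : 0 ≤ u) (hs : 0 ≤ s) (ht : 0 ≤ t) :
    coexceed P (fun ω => Θ k ω * X k ω) (fun ω => Θ i ω * X i ω) (fun ω => Δ j ω * Y j ω) u s t ≤
      coexceed P (X k) (X i) (Y j) (u / K) (s / K) (t / K) := by
  refine measureReal_mono_of_ae ?_
  filter_upwards [(hw k j).left_mem, (hw i j).left_mem, (hw i j).right_mem] with ω h1 h2 h3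
  rintro ⟨a, b, c⟩
  rw [abs_mul, abs_of_nonneg h1.1] at a
  exact ⟨(pos_and_div_lt_of_lt_mul h1.1 h1.2 hu a).2, (pos_and_div_lt_of_lt_mul h2.1 h2.2 hs b).2,
    (pos_and_div_lt_of_lt_mul h3.1 h3.2 ht c).2⟩

/-- Two weighted jumps in the first sequence and one in the second need positive weights. -/
lemma coexceed_weighted_eq_zero (hw : ∀ i j, BoundedWeights P (Θ i) (Δ j) (X i) (Y j) K)
    {k i : Fin n} {j : Fin m} (h : P {ω | 0 < Θ k ω ∧ 0 < Δ j ω} = 0 ∨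
      P {ω | 0 < Θ i ω ∧ 0 < Δ j ω} = 0) {u s t : ℝ} (hu : 0 ≤ u) (hs : 0 ≤ s) (ht : 0 ≤ t) :
    coexceed P (fun ω => Θ k ω * X k ω) (fun ω => Θ i ω * X i ω) (fun ω => Δ j ω * Y j ω) u s t
      = 0 := by
  have hpos : ∀ᵐ ω ∂P, (u < |Θ k ω * X k ω| ∧ s < Θ i ω * X i ω ∧ t < Δ j ω * Y j ω) →
      0 < Θ k ω ∧ 0 < Θ i ω ∧ 0 < Δ j ω := by
    filter_upwards [(hw k j).left_mem, (hw i j).left_mem, (hw i j).right_mem] with ω h1 h2 h3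
    rintro ⟨a, b, c⟩
    rw [abs_mul, abs_of_nonneg h1.1] at a
    exact ⟨(pos_and_div_lt_of_lt_mul h1.1 h1.2 hu a).1,
      (pos_and_div_lt_of_lt_mul h2.1 h2.2 hs b).1, (pos_and_div_lt_of_lt_mul h3.1 h3.2 ht c).1⟩
  refine le_antisymm ?_ (coexceed_nonneg _ _ _ _ _ _)
  -- The event lies in either of the two events of positive weights.
  rcases h with h | h
  · rw [← (measureReal_eq_zero_iff (μ := P)).2 h]
    exact measureReal_mono_of_ae (hpos.mono fun ω h h' => ⟨(h h').1, (h h').2.2⟩)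
  · rw [← (measureReal_eq_zero_iff (μ := P)).2 h]
    exact measureReal_mono_of_ae (hpos.mono fun ω h h' => ⟨(h h').2.1, (h h').2.2⟩)

/-- Under quasi asymptotic independence two jumps in the first sequence are improbable, the second
one being measured on the linear scale. -/
lemma HalfGQAI.coexceed_le (h : HalfGQAI P X Y)
    (hw : ∀ i j, BoundedWeights P (Θ i) (Δ j) (X i) (Y j) K)
    (hdom : ∀ i j, DominatedPair P (X i) (Y j)) {ε c : ℝ} (hε : 0 < ε) (hc : 0 < c)
    {k i : Fin n} (hki : k ≠ i) (j : Fin m) :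
    ∀ᶠ p : ℝ × ℝ in atTop ×ˢ atTop,
      coexceed P (fun ω => Θ k ω * X k ω) (fun ω => Θ i ω * X i ω) (fun ω => Δ j ω * Y j ω)
        (c * p.1 / n) (p.1 / n) (p.2 / m) ≤ ε * doubleSum P X Y Θ Δ p := by
  have hn : (0 : ℝ) < n := by exact_mod_cast Fin.pos i
  have hm : (0 : ℝ) < m := by exact_mod_cast Fin.pos j
  have hK := (hw i j).bound_pos
  by_cases hact : P {ω | 0 < Θ k ω ∧ 0 < Δ j ω} = 0 ∨ P {ω | 0 < Θ i ω ∧ 0 < Δ j ω} = 0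
  · filter_upwards [eventually_pos_prod] with p hp
    have := hp.1
    have := hp.2
    rw [coexceed_weighted_eq_zero hw hact (by positivity) (by positivity) (by positivity)]
    exact mul_nonneg hε.le ((jointReal_nonneg _ _ _).trans
      (jointReal_le_doubleSum X Y Θ Δ p i j))
  rw [not_or] at hact
  -- One scale below all three levels, after division by the bound of the weights.
  set s : ℝ := min (c / n / K) (min (1 / n / K) (1 / m / K))
  have hs : 0 < s := by positivity
  obtain ⟨C₁, hC₁, h1⟩ := (hw k j).jointReal_scale_le (hdom k j) hact.1 hs
  obtain ⟨C₂, hC₂, h2⟩ := (hw i j).jointReal_scale_le (hdom i j) hact.2 hs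
  have hq := (h k i hki j).eventually_le_const
    (ENNReal.ofReal_pos.2 (show 0 < ε / (C₁ + C₂) by positivity))
  filter_upwards [h1, h2, (tendsto_mul_atTop_prod hs).eventually hq, eventually_pos_prod]
    with p h1 h2 h3 hp
  have hp1 := hp.1
  have hp2 := hp.2
  have h4 : coexceed P (X k) (X i) (Y j) (s * p.1) (s * p.1) (s * p.2) ≤ ε / (C₁ + C₂) *
      (jointReal P (X k) (Y j) (s * p.1, s * p.2) + jointReal P (X i) (Y j) (s * p.1, s * p.2)) := by
    have hfin : ∀ l, jointTail P (X l) (Y j) (s * p.1) (s * p.2) ≠ ∞ := fun l => measure_ne_top _ _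
    have h5 := (ENNReal.div_le_iff_le_mul (Or.inr ENNReal.ofReal_ne_top)
      (Or.inl (ENNReal.add_ne_top.2 ⟨hfin k, hfin i⟩))).1 h3
    have h6 := ENNReal.toReal_mono (ENNReal.mul_ne_top ENNReal.ofReal_ne_top
      (ENNReal.add_ne_top.2 ⟨hfin k, hfin i⟩)) h5
    rw [ENNReal.toReal_mul, ENNReal.toReal_ofReal (by positivity),
      ENNReal.toReal_add (hfin k) (hfin i)] at h6
    exact h6
  have e1 : s * p.1 ≤ c * p.1 / n / K := by
    calc s * p.1 ≤ c / n / K * p.1 := by gcongr; exact min_le_left _ _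
      _ = _ := by ring
  have e2 : s * p.1 ≤ p.1 / n / K := by
    calc s * p.1 ≤ 1 / n / K * p.1 := by
          gcongr; exact (min_le_right _ _).trans (min_le_left _ _)
      _ = _ := by ring
  have e3 : s * p.2 ≤ p.2 / m / K := by
    calc s * p.2 ≤ 1 / m / K * p.2 := by
          gcongr; exact (min_le_right _ _).trans (min_le_right _ _)
      _ = _ := by ring
  calc _ ≤ _ := coexceed_weighted_le hw k i j (by positivity) (by positivity) (by positivity)
    _ ≤ _ := coexceed_anti _ _ _ e1 e2 e3
    _ ≤ _ := h4
    _ ≤ ε / (C₁ + C₂) * (C₁ * doubleSum P X Y Θ Δ p + C₂ * doubleSum P X Y Θ Δ p) := by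
        gcongr
        · exact h1.trans (by gcongr; exact jointReal_le_doubleSum X Y Θ Δ p k j)
        · exact h2.trans (by gcongr; exact jointReal_le_doubleSum X Y Θ Δ p i j)
    _ = _ := by field_simp

/-- Under tail asymptotic independence two jumps in the first sequence are improbable, even if the
second one is measured by a large constant. -/
lemma HalfGTAI.coexceed_le (h : HalfGTAI P X Y)
    (hw : ∀ i j, BoundedWeights P (Θ i) (Δ j) (X i) (Y j) K)
    (hdom : ∀ i j, DominatedPair P (X i) (Y j)) {ε : ℝ} (hε : 0 < ε)
    {k i : Fin n} (hki : k ≠ i) (j : Fin m) :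
    ∀ᶠ a : ℝ in atTop, ∀ᶠ p : ℝ × ℝ in atTop ×ˢ atTop,
      coexceed P (fun ω => Θ k ω * X k ω) (fun ω => Θ i ω * X i ω) (fun ω => Δ j ω * Y j ω)
        (a / n) (p.1 / n) (p.2 / m) ≤ ε * doubleSum P X Y Θ Δ p := by
  have hn : (0 : ℝ) < n := by exact_mod_cast Fin.pos i
  have hm : (0 : ℝ) < m := by exact_mod_cast Fin.pos j
  have hK := (hw i j).bound_pos
  by_cases hact : P {ω | 0 < Θ i ω ∧ 0 < Δ j ω} = 0
  · filter_upwards [eventually_ge_atTop 0] with a ha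
    filter_upwards [eventually_pos_prod] with p hp
    have := hp.1
    have := hp.2
    rw [coexceed_weighted_eq_zero hw (Or.inr hact) (by positivity) (by positivity) (by positivity)]
    exact mul_nonneg hε.le ((jointReal_nonneg _ _ _).trans
      (jointReal_le_doubleSum X Y Θ Δ p i j))
  set s : ℝ := min (1 / n / K) (1 / m / K)
  have hs : 0 < s := by positivity
  obtain ⟨C, hC, h1⟩ := (hw i j).jointReal_scale_le (hdom i j) hact hs
  have hq := ((h k i hki j).eventually_le_const
    (ENNReal.ofReal_pos.2 (show 0 < ε / C by positivity))).curry
  have hlim : Tendsto (fun a : ℝ => a / n / K) atTop atTop :=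
    (tendsto_id.atTop_div_const hn).atTop_div_const hK
  filter_upwards [hlim.eventually hq, eventually_ge_atTop 0] with a ha ha0
  filter_upwards [h1, (tendsto_mul_atTop_prod hs).eventually ha, eventually_pos_prod]
    with p h1 h3 hp
  have hp1 := hp.1
  have hp2 := hp.2
  have h4 : coexceed P (X k) (X i) (Y j) (a / n / K) (s * p.1) (s * p.2) ≤ ε / C *
      jointReal P (X i) (Y j) (s * p.1, s * p.2) := by
    have hmeas : MeasurableSet {ω | s * p.1 < X i ω ∧ s * p.2 < Y j ω} :=
      (measurableSet_lt measurable_const (hw i j).measurable_left).inter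
        (measurableSet_lt measurable_const (hw i j).measurable_right)
    rw [cond_apply hmeas, ← ENNReal.div_eq_inv_mul] at h3
    refine (le_of_eq ?_).trans (measureReal_le_of_div_le (by positivity) h3)
    unfold coexceed
    congr 1
    ext ω
    simp only [Set.mem_inter_iff, Set.mem_ofPred_eq]
    tauto
  have e2 : s * p.1 ≤ p.1 / n / K := by
    calc s * p.1 ≤ 1 / n / K * p.1 := by gcongr; exact min_le_left _ _
      _ = _ := by ring
  have e3 : s * p.2 ≤ p.2 / m / K := by
    calc s * p.2 ≤ 1 / m / K * p.2 := by gcongr; exact min_le_right _ _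
      _ = _ := by ring
  calc _ ≤ _ := coexceed_weighted_le hw k i j (by positivity) (by positivity) (by positivity)
    _ ≤ _ := coexceed_anti _ _ _ le_rfl e2 e3
    _ ≤ _ := h4
    _ ≤ ε / C * (C * doubleSum P X Y Θ Δ p) := by
        gcongr
        exact h1.trans (by gcongr; exact jointReal_le_doubleSum X Y Θ Δ p i j)
    _ = _ := by field_simp

end TwoJumps

/-! ### Sums and maxima -/

section Functionals

variable {α : Type*} {n : ℕ} (Θ X : Fin n → α → ℝ)

lemma jumpFunctional_wSum : JumpFunctional (fun i ω => Θ i ω * X i ω) (wSum Θ X) where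
  le_sum ω := Finset.sum_le_sum fun i _ => le_max_left _ _
  lt_of_jump ω i x g hg h1 h2 := by
    have hn : (0 : ℝ) < n := by exact_mod_cast Fin.pos i
    have key : ∑ k, ((-(g / n)) + if k = i then x + g else 0) < ∑ k, Θ k ω * X k ω := by
      have hgn : 0 ≤ g / n := by positivity
      refine Finset.sum_lt_sum (fun k _ => ?_) ⟨i, Finset.mem_univ i, ?_⟩
      · split_ifs with hk
        · subst hk
          linarith
        · rw [add_zero]
          exact (abs_le.1 (h2 k hk)).1
      · rw [if_pos rfl]
        linarith
    rw [Finset.sum_add_distrib] at key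
    simp only [Finset.sum_const, Finset.card_univ, Fintype.card_fin, nsmul_eq_mul,
      Finset.sum_ite_eq', Finset.mem_univ, if_true] at key
    rw [mul_neg, mul_div_cancel₀ _ hn.ne'] at key
    unfold wSum
    linarith

lemma jumpFunctional_wMaxSum (hn : 1 ≤ n) :
    JumpFunctional (fun i ω => Θ i ω * X i ω) (wMaxSum Θ X) where
  le_sum ω := by
    have : Nonempty (Fin n) := ⟨⟨0, hn⟩⟩
    refine ciSup_le fun k => (Finset.sum_le_sum fun i _ => le_max_left _ (0 : ℝ)).trans ?_
    exact Finset.sum_le_sum_of_subset_of_nonneg (Finset.subset_univ _)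
      fun i _ _ => le_max_right _ _
  lt_of_jump ω i x g hg h1 h2 := by
    refine ((jumpFunctional_wSum Θ X).lt_of_jump ω i x g hg h1 h2).trans_le ?_
    have hlast : Finset.Iic (⟨n - 1, by omega⟩ : Fin n) = Finset.univ := by
      ext k
      simp only [Finset.mem_Iic, Finset.mem_univ, iff_true, Fin.le_def]
      omega
    have := le_ciSup (Finite.bddAbove_range
      (fun k : Fin n => ∑ i ∈ Finset.Iic k, Θ i ω * X i ω)) ⟨n - 1, by omega⟩
    rw [hlast] at this
    exact this

lemma jumpFunctional_wMax (hn : 1 ≤ n) :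
    JumpFunctional (fun i ω => Θ i ω * X i ω) (wMax Θ X) where
  le_sum ω := by
    have : Nonempty (Fin n) := ⟨⟨0, hn⟩⟩
    refine ciSup_le fun k => (le_max_left _ (0 : ℝ)).trans ?_
    exact Finset.single_le_sum (f := fun k => max (Θ k ω * X k ω) 0)
      (fun i _ => le_max_right _ _) (Finset.mem_univ k)
  lt_of_jump ω i x g hg h1 _ := by
    have := le_ciSup (Finite.bddAbove_range (fun k : Fin n => Θ k ω * X k ω)) i
    unfold wMax
    linarith

end Functionals

/-! ### The two asymptotic results -/

section Main

variable [IsProbabilityMeasure P] {n m : ℕ} {X Θ : Fin n → Ω → ℝ} {Y Δ : Fin m → Ω → ℝ}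

/-- Consistent variation: the gap is a small multiple of the argument. -/
lemma isEquivalent_of_classC2 (hn : 1 ≤ n) (hm : 1 ≤ m) (hX : ∀ i, Measurable (X i))
    (hY : ∀ j, Measurable (Y j)) (hG : GQAI P X Y) (hC : ∀ i j, ClassC2 P (X i) (Y j))
    (hA : AdmissibleWeights P X Y Θ Δ) {S T : Ω → ℝ}
    (hS : JumpFunctional (fun i ω => Θ i ω * X i ω) S)
    (hT : JumpFunctional (fun j ω => Δ j ω * Y j ω) T) :
    jointReal P S T ~[atTop ×ˢ atTop] doubleSum P X Y Θ Δ := by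
  obtain ⟨K, hw⟩ := hA.exists_boundedWeights hn hm hX hY
  have hdom := fun i j => (hC i j).dominatedPair
  refine isEquivalent_of_gap (fun i ω => Θ i ω * X i ω) (fun j ω => Δ j ω * Y j ω)
    (fun i => (hA.measurable_left i).mul (hX i)) (fun j => (hA.measurable_right j).mul (hY j))
    (fun _ => rfl) (fun ε hε => ?_) hS hT
  have hnear : ∀ᶠ z in 𝓝[<] (1 : ℝ), z ∈ Set.Ioo (0 : ℝ) 1 := Ioo_mem_nhdsLT one_pos
  obtain ⟨z, hz, hz0, hz1⟩ := ((eventually_all.2 fun i => eventually_all.2 fun j =>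
    (hC i j).eventually_le hε).and hnear).exists
  have hmain := fun i j => (hw i j).jointReal_mul_le hz0 (show 0 ≤ 1 + ε by linarith) (hz i j)
  have hc : 0 < 1 - z := by linarith
  refine ⟨fun x => (1 - z) * x, fun x hx => by positivity, fun i j => ?_, fun i j => ?_,
    fun k i hki j => hG.1.coexceed_le hw hdom hε hc hki j, fun l j hlj i => ?_⟩
  · filter_upwards [hmain i j] with p hp
    have e : ∀ x : ℝ, x - (1 - z) * x = z * x := fun x => by ring
    simpa only [e] using hp
  · have h2z : 0 < 2 - z := by linarith
    filter_upwards [(tendsto_mul_atTop_prod h2z).eventually (hmain i j), eventually_pos_prod]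
      with p hp hpos
    have e : ∀ x : ℝ, x + (1 - z) * x = (2 - z) * x := fun x => by ring
    simp only [e]
    -- `z (2 - z) ≤ 1`, so scaling by `2 - z` undoes at most the scaling by `z`.
    have hle : z * (2 - z) ≤ 1 := by nlinarith [sq_nonneg (1 - z)]
    refine (jointReal_anti _ _ ?_ ?_).trans hp
    · simp only [← mul_assoc]
      exact mul_le_of_le_one_left hpos.1.le hle
    · simp only [← mul_assoc]
      exact mul_le_of_le_one_left hpos.2.le hle
  · filter_upwards [tendsto_prod_swap.eventually (hG.2.coexceed_le (fun j i => (hw i j).swap)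
      (fun j i => (hdom i j).swap) hε hc hlj i)] with p hp
    rw [doubleSum_swap] at hp
    exact hp

/-- Long tails: the gap is a large constant. -/
lemma isEquivalent_of_classL2 (hn : 1 ≤ n) (hm : 1 ≤ m) (hX : ∀ i, Measurable (X i))
    (hY : ∀ j, Measurable (Y j)) (hG : GTAI P X Y) (hD : ∀ i j, ClassD2 P (X i) (Y j))
    (hL : ∀ i j, ClassL2 P (X i) (Y j)) (hA : AdmissibleWeights P X Y Θ Δ) {S T : Ω → ℝ}
    (hS : JumpFunctional (fun i ω => Θ i ω * X i ω) S)
    (hT : JumpFunctional (fun j ω => Δ j ω * Y j ω) T) :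
    jointReal P S T ~[atTop ×ˢ atTop] doubleSum P X Y Θ Δ := by
  obtain ⟨K, hw⟩ := hA.exists_boundedWeights hn hm hX hY
  have hdom := fun i j => (hD i j).dominatedPair
  refine isEquivalent_of_gap (fun i ω => Θ i ω * X i ω) (fun j ω => Δ j ω * Y j ω)
    (fun i => (hA.measurable_left i).mul (hX i)) (fun j => (hA.measurable_right j).mul (hY j))
    (fun _ => rfl) (fun ε hε => ?_) hS hT
  have hl := eventually_all.2 fun k => eventually_all.2 fun i => eventually_all.2 fun hki =>
    eventually_all.2 fun j => hG.1.coexceed_le hw hdom hε (k := k) (i := i) hki j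
  have hr := eventually_all.2 fun l => eventually_all.2 fun j => eventually_all.2 fun hlj =>
    eventually_all.2 fun i => hG.2.coexceed_le (fun j i => (hw i j).swap)
      (fun j i => (hdom i j).swap) hε (k := l) (i := j) hlj i
  obtain ⟨a, ⟨hal, har⟩, ha⟩ := ((hl.and hr).and (eventually_gt_atTop 0)).exists
  have hmain := fun i j => (hw i j).jointReal_sub_le (hdom i j)
    (fun ε a hε ha => (hL i j).eventually_le hε ha) hε ha
  refine ⟨fun _ => a, fun _ _ => ha.le, hmain, fun i j => ?_, hal, fun l j hlj i => ?_⟩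
  · filter_upwards [(tendsto_add_atTop_prod a).eventually (hmain i j)] with p hp
    simpa using hp
  · filter_upwards [tendsto_prod_swap.eventually (har l j hlj i)] with p hp
    rw [doubleSum_swap] at hp
    exact hp

end Main

end HeavyTail

theorem theorem5p1 {Ω : Type*} [MeasurableSpace Ω] (P : Measure Ω) [IsProbabilityMeasure P] :
    (∀ (n m : ℕ), 1 ≤ n → 1 ≤ m →
      ∀ (X Θ : Fin n → Ω → ℝ) (Y Δ : Fin m → Ω → ℝ),
        (∀ i, Measurable (X i)) → (∀ j, Measurable (Y j)) →
        HeavyTail.GQAI P X Y →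
        (∀ i, HeavyTail.ClassC P (X i)) → (∀ j, HeavyTail.ClassC P (Y j)) →
        (∀ i j, HeavyTail.ClassC2 P (X i) (Y j)) →
        HeavyTail.AdmissibleWeights P X Y Θ Δ →
        ((fun p : ℝ × ℝ =>
            P.real {ω | p.1 < HeavyTail.wSum Θ X ω ∧ p.2 < HeavyTail.wSum Δ Y ω})
          ~[atTop ×ˢ atTop]
          (fun p : ℝ × ℝ =>
            P.real {ω | p.1 < HeavyTail.wMaxSum Θ X ω ∧ p.2 < HeavyTail.wMaxSum Δ Y ω})) ∧
        ((fun p : ℝ × ℝ =>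
            P.real {ω | p.1 < HeavyTail.wMaxSum Θ X ω ∧ p.2 < HeavyTail.wMaxSum Δ Y ω})
          ~[atTop ×ˢ atTop] HeavyTail.doubleSum P X Y Θ Δ)) ∧
    (∀ (n : ℕ), 1 ≤ n →
      ∀ (X Θ Y Δ : Fin n → Ω → ℝ),
        (∀ i, Measurable (X i)) → (∀ j, Measurable (Y j)) →
        HeavyTail.GTAI P X Y →
        (∀ i, HeavyTail.ClassD P (X i) ∧ HeavyTail.ClassL P (X i)) →
        (∀ j, HeavyTail.ClassD P (Y j) ∧ HeavyTail.ClassL P (Y j)) →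
        (∀ i j, HeavyTail.ClassD2 P (X i) (Y j) ∧ HeavyTail.ClassL2 P (X i) (Y j)) →
        HeavyTail.TAI P X → HeavyTail.TAI P Y →
        HeavyTail.AdmissibleWeights P X Y Θ Δ →
        (∃ r : ℝ, (⨆ i, HeavyTail.upperMatuszewska P (X i)) < (r : EReal) ∧
          ∀ i, Integrable (fun ω => Θ i ω ^ r) P) →
        (∃ q : ℝ, (⨆ j, HeavyTail.upperMatuszewska P (Y j)) < (q : EReal) ∧
          ∀ j, Integrable (fun ω => Δ j ω ^ q) P) →
        ((fun p : ℝ × ℝ =>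
            P.real {ω | p.1 < HeavyTail.wSum Θ X ω ∧ p.2 < HeavyTail.wSum Δ Y ω})
          ~[atTop ×ˢ atTop]
          (fun p : ℝ × ℝ =>
            P.real {ω | p.1 < HeavyTail.wMaxSum Θ X ω ∧ p.2 < HeavyTail.wMaxSum Δ Y ω})) ∧
        ((fun p : ℝ × ℝ =>
            P.real {ω | p.1 < HeavyTail.wMaxSum Θ X ω ∧ p.2 < HeavyTail.wMaxSum Δ Y ω})
          ~[atTop ×ˢ atTop]
          (fun p : ℝ × ℝ =>
            P.real {ω | p.1 < HeavyTail.wMax Θ X ω ∧ p.2 < HeavyTail.wMax Δ Y ω})) ∧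
        ((fun p : ℝ × ℝ =>
            P.real {ω | p.1 < HeavyTail.wMax Θ X ω ∧ p.2 < HeavyTail.wMax Δ Y ω})
          ~[atTop ×ˢ atTop] HeavyTail.doubleSum P X Y Θ Δ)) := by
  refine ⟨fun n m hn hm X Θ Y Δ hX hY hG _ _ hC hA => ?_,
    fun n hn X Θ Y Δ hX hY hG _ _ hDL _ _ hA _ _ => ?_⟩
  · have h1 := HeavyTail.isEquivalent_of_classC2 hn hm hX hY hG hC hA
      (HeavyTail.jumpFunctional_wSum Θ X) (HeavyTail.jumpFunctional_wSum Δ Y)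
    have h2 := HeavyTail.isEquivalent_of_classC2 hn hm hX hY hG hC hA
      (HeavyTail.jumpFunctional_wMaxSum Θ X hn) (HeavyTail.jumpFunctional_wMaxSum Δ Y hm)
    exact ⟨h1.trans h2.symm, h2⟩
  · have hD := fun i j => (hDL i j).1
    have hL := fun i j => (hDL i j).2
    have h1 := HeavyTail.isEquivalent_of_classL2 hn hn hX hY hG hD hL hA
      (HeavyTail.jumpFunctional_wSum Θ X) (HeavyTail.jumpFunctional_wSum Δ Y)
    have h2 := HeavyTail.isEquivalent_of_classL2 hn hn hX hY hG hD hL hA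
      (HeavyTail.jumpFunctional_wMaxSum Θ X hn) (HeavyTail.jumpFunctional_wMaxSum Δ Y hn)
    have h3 := HeavyTail.isEquivalent_of_classL2 hn hn hX hY hG hD hL hA
      (HeavyTail.jumpFunctional_wMax Θ X hn) (HeavyTail.jumpFunctional_wMax Δ Y hn)
    exact ⟨h1.trans h2.symm, h2.trans h3.symm, h3⟩
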